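/- **Guided random walk.** Let $(x_t)_{t\ge 0}$ be a nearest-neighbour walk in $\mathbb Z^2$ with $x_0=0$ (the instructions) and let $p\in[0,1]$. The guided random walk is $X_0=0$ and, independently in each step, $X_{t+1}-X_t=x_{t+1}-x_t$ with probability $1-p$, while with probability $p$ it is uniform on $\{(\pm1,0),(0,\pm1)\}$. For $x_{\mathrm{home}}\in\mathbb Z^2$ let $T=\inf\{t\ge 0: X_t=x_{\mathrm{home}}\}\in\mathbb N\cup\{\infty\}$. **Sweeping strategy with parameters $p_0\in(0,1)$ and $A,B>0$.** The first $t_0\geq 2$ instructions form an arbitrary fixed closed walk from the origin to itself. From time $t_0$ on, the instructions consist of consecutive phases, each of which starts and ends with $x_t=0$. For a phase that starts at time $t$ put $$W=\Big\lceil \tfrac{A\sqrt t}{1-p_0}\Big\rceil,\quad H=\Big\lceil \tfrac{B\sqrt t}{1-p_0}\Big\rceil,\quad G=\Big\lceil \tfrac{1}{1-p_0}\tfrac{\sqrt t}{\ln t}\Big\rceil,\quad N=\Big\lceil \tfrac{2H}{G}\Big\rceil,\quad M=G+\lceil t^{1/3}\rceil,$$ and let $Z$ be uniform on $\{1,\dots,M\}$,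 independently for each phase and independently of the mistakes of the agent. The instructions of the phase are: 1. $W$ steps west, then $H$ steps south; 2. $Z$ steps north; 3. $N$ horizontal lines of $2W$ steps each, alternatingly to the east and to the west (the first to the east), with $G$ steps north between consecutive lines; 4. $M-Z$ steps north, and then a shortest return to $(0,0)$, first horizontally and then vertically. (The duration of a phase does not depend on $Z$.) **Proposition.** Let $0<p_0<1$, $\alpha>0$, and suppose that $a>0$ satisfies $$\left(1-4e^{-\frac{a^2}{4}+2\alpha}\right)\frac{(1-p_0)^2}{2a^2p_0\sqrt{3-2p_0}}>\alpha .$$ Then, for every $0\le p\le p_0$ and every $x_{\mathrm{home}}\in\mathbb Z^2$, the guided random walk with mistake probability $p$ that follows the sweeping strategy with parameters $A=a\sqrt{\frac{p_0}{2}(3-2p_0)}$ and $B=a\sqrt{\frac{p_0}{2}}$ satisfies $\mathbb P(T>t)=O(t^{-\alpha})$ as $t\to\infty$. In particular, if $\alpha>1$, then $\mathbb E[T]<\infty$. -/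

import Mathlib

open MeasureTheory ProbabilityTheory Filter

namespace GuidedWalk

/-- The four cardinal directions. -/
inductive Dir
  | east | west | north | south
  deriving DecidableEq

/-- The unit vector of a cardinal direction. -/
def Dir.vec : Dir → ℤ × ℤ
  | .east => (1, 0)
  | .west => (-1, 0)
  | .north => (0, 1)
  | .south => (0, -1)

/-- The displacement produced by a finite list of moves. -/
def displacement (l : List Dir) : ℤ × ℤ := (l.map Dir.vec).sum

/-- What the agent does in one time step: it follows the current instruction, or it makes a mistake
and moves in the given direction. -/
inductive Outcome
  | follow
  | mistake (d : Dir)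
  deriving DecidableEq

instance : MeasurableSpace Outcome := ⊤

/-- The position at time `t` of the agent started at the origin, when the instructions are
the walk `x` and the outcomes of the successive time steps are `ξ 0, ξ 1, …`. -/
def guidedWalk (x : ℕ → ℤ × ℤ) (ξ : ℕ → Outcome) : ℕ → ℤ × ℤ
  | 0 => 0
  | t + 1 => guidedWalk x ξ t +
      match ξ t with
      | .follow => x (t + 1) - x t
      | .mistake d => d.vec

/-- The first time at which the trajectory `X` is at `home` (`⊤` if there is none). -/
noncomputable def hittingTime (X : ℕ → ℤ × ℤ) (home : ℤ × ℤ) : ℕ∞ :=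
  ⨅ (t : ℕ) (_ : X t = home), (t : ℕ∞)

/-! ### The sweeping strategy -/

section Strategy

variable (p₀ A B : ℝ)

/-- Half of the width of the swept box, for a phase starting at time `t`. -/
noncomputable def boxW (t : ℕ) : ℕ := ⌈1 / (1 - p₀) * A * √(t : ℝ)⌉₊

/-- Half of the height of the swept box, for a phase starting at time `t`. -/
noncomputable def boxH (t : ℕ) : ℕ := ⌈1 / (1 - p₀) * B * √(t : ℝ)⌉₊

/-- The gap between consecutive horizontal lines. -/
noncomputable def gap (t : ℕ) : ℕ := ⌈1 / (1 - p₀) * (√(t : ℝ) / Real.log t)⌉₊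

/-- The number of horizontal lines. -/
noncomputable def numLines (t : ℕ) : ℕ := ⌈2 * (boxH p₀ B t : ℝ) / (gap p₀ t : ℝ)⌉₊

/-- The random shift of a phase starting at time `t` is uniform on `{1, …, maxShift t}`. -/
noncomputable def maxShift (t : ℕ) : ℕ := gap p₀ t + ⌈(t : ℝ) ^ ((1 : ℝ) / 3)⌉₊

/-- `n` horizontal lines of length `2 * w`, traversed alternatingly to the east and to the west
(the first one to the east), with `g` steps north between consecutive lines. -/
def zigzag (w g : ℕ) : ℕ → List Dir
  | 0 => []
  | n + 1 => zigzag w g n ++ (if n = 0 then [] else List.replicate g Dir.north) ++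
      List.replicate (2 * w) (if Even n then Dir.east else Dir.west)

/-- A shortest walk with displacement `v`: first horizontally, then vertically. -/
def straight (v : ℤ × ℤ) : List Dir :=
  List.replicate v.1.natAbs (if 0 ≤ v.1 then Dir.east else Dir.west) ++
    List.replicate v.2.natAbs (if 0 ≤ v.2 then Dir.north else Dir.south)

/-- The moves of a phase that starts at time `t` with shift `z`, up to the return to the origin. -/
noncomputable def sweep (t z : ℕ) : List Dir :=
  List.replicate (boxW p₀ A t) Dir.west ++ List.replicate (boxH p₀ B t) Dir.south ++
    List.replicate z Dir.north ++
    zigzag (boxW p₀ A t) (gap p₀ t) (numLines p₀ B t) ++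
    List.replicate (maxShift p₀ t - z) Dir.north

/-- The instructions of a phase that starts at time `t` with shift `z`. -/
noncomputable def phase (t z : ℕ) : List Dir :=
  sweep p₀ A B t z ++ straight (-displacement (sweep p₀ A B t z))

/-- The duration of a phase that starts at time `t`; see `length_phase`: it does not depend on
the shift. -/
noncomputable def phaseLength (t : ℕ) : ℕ := (phase p₀ A B t 0).length

theorem length_phase (t z : ℕ) (hz : z ≤ maxShift p₀ t) :
    (phase p₀ A B t z).length = phaseLength p₀ A B t := by
  have hd : displacement (sweep p₀ A B t z) = displacement (sweep p₀ A B t 0) := by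
    obtain ⟨k, hk⟩ := Nat.exists_eq_add_of_le hz
    have hv : (maxShift p₀ t - z) • Dir.north.vec + z • Dir.north.vec
        = maxShift p₀ t • Dir.north.vec := by
      rw [← add_smul, Nat.sub_add_cancel hz]
    simp only [displacement, sweep, List.map_append, List.sum_append, List.map_replicate,
      List.sum_replicate, Nat.sub_zero, zero_smul, add_zero]
    rw [← hv]
    abel
  have hl : (sweep p₀ A B t z).length = (sweep p₀ A B t 0).length := by
    simp only [sweep, List.length_append, List.length_replicate]
    omega
  simp only [phaseLength, phase, List.length_append, hd, hl]

/-- The starting time of phase `i`, when the first phase starts at time `t₀`. -/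
noncomputable def startTime (t₀ : ℕ) : ℕ → ℕ
  | 0 => t₀
  | i + 1 => startTime t₀ i + phaseLength p₀ A B (startTime t₀ i)

/-- The moves `l₀` made before the first phase, followed by phases `0, …, n - 1`, where phase `i`
has shift `z i`. -/
noncomputable def moves (l₀ : List Dir) (z : ℕ → ℕ) : ℕ → List Dir
  | 0 => l₀
  | n + 1 => moves l₀ z n ++ phase p₀ A B (startTime p₀ A B l₀.length n) (z n)

/-- The instructions `x_t` of the sweeping strategy with initial moves `l₀` and shifts `z`.
Every phase lasts at least one step, so the first `t` phases determine `x_t`. -/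
noncomputable def sweepingInstructions (l₀ : List Dir) (z : ℕ → ℕ) (t : ℕ) : ℤ × ℤ :=
  displacement ((moves p₀ A B l₀ z t).take t)

end Strategy

/-- The randomness of the guided random walk with mistake probability `p` that follows the sweeping
strategy: `ξ t` is the outcome of time step `t` (a mistake has probability `p`, and its direction is
then uniform), `Z i` is the shift of phase `i`, and all these random variables are independent. -/
structure IsSweepingRandomness {Ω : Type*} [MeasurableSpace Ω] (μ : Measure Ω)
    (p p₀ A B : ℝ) (t₀ : ℕ) (ξ : ℕ → Ω → Outcome) (Z : ℕ → Ω → ℕ) : Prop where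
  measurable_outcome : ∀ t, Measurable (ξ t)
  measurable_shift : ∀ i, Measurable (Z i)
  prob_follow : ∀ t, μ {ω | ξ t ω = .follow} = ENNReal.ofReal (1 - p)
  prob_mistake : ∀ t d, μ {ω | ξ t ω = .mistake d} = ENNReal.ofReal (p / 4)
  prob_shift : ∀ i, ∀ z ∈ Finset.Icc 1 (maxShift p₀ (startTime p₀ A B t₀ i)),
    μ {ω | Z i ω = z} = (maxShift p₀ (startTime p₀ A B t₀ i) : ENNReal)⁻¹
  indep_outcome : iIndepFun ξ μ
  indep_shift : iIndepFun Z μ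
  indep_outcome_shift : IndepFun (fun ω t => ξ t ω) (fun ω i => Z i ω) μ

/-- The time at which the agent that follows the sweeping strategy finds `home`. -/
noncomputable def sweepingTime {Ω : Type*} (p₀ A B : ℝ) (l₀ : List Dir)
    (ξ : ℕ → Ω → Outcome) (Z : ℕ → Ω → ℕ) (home : ℤ × ℤ) (ω : Ω) : ℕ∞ :=
  hittingTime
    (guidedWalk (sweepingInstructions p₀ A B l₀ (fun i => Z i ω)) (fun t => ξ t ω)) home

end GuidedWalk

namespace GuidedWalk

/-! ### Means over independent outcomes -/

/-! On average the agent carries out a fraction `1 - p ≥ 1 - p₀` of each instructed displacement, so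
a phase starting at time `t` sweeps a box around the agent's position with half-sides at least about
`A√t` and `B√t`. The phase lasts of order `√t ln t` steps, and with high probability its random
deviations stay below a small multiple of `t ^ (1/3)`, which is the excess of the shift range over
the gap.

Suppose that the home lies in the box. Follow one agent through `M` steps north and then through the
lines. The path of the northward steps runs from bottom to top, that of a suitable line from left to
right, and `exists_add_eq_zero` forces them to match up: for some shift, the same outcomes lead to
the home (`exists_shift_hit`). As the outcomes are i.i.d., the hitting probabilities of the `M`
shifts therefore add up to almost `1` (`one_sub_le_sum_wordMean_hits`), and a uniform shift succeeds
with probability about `1 / M`. If `L` is the duration of the phase, then `L M / t` tends to `1 / c`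
with `c = (1 - p₀)² / (2 a² p₀ √(3 - 2 p₀))`, so the rate of discovery is about `c / t` per step.

It remains to bound the probability of being far from home without having found it. For the four
directions `e`, let `F e i` be an exponential moment of the position at the start of phase `i`, on
the event of survival, with an exponent proportional to `1 / √t`. A phase has zero total
displacement, so only its variance makes these moments grow (`survivalMean_exp_succ_le`); rescaling
the exponent from one phase to the next costs a weighted AM-GM inequality
(`survivalMean_exp_mul_le`). The induction in `exists_le_rpow_neg` shows together that the survival
probability is at most `C t ^ (-α)` and each moment at most `K C t ^ (-α)`, with `ln K` slightly
above `a² / 4 + 2 α`. By Markov's inequality the box is missed with weight at most about `4 exp (-a²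
/ 4 + 2 α)` relative to `C t ^ (-α)`. The effective rate of discovery is `(1 - 4 exp (-a² / 4 + 2
α)) c / t`, and the hypothesis says that it exceeds `α / t`. -/

instance : Fintype Dir := ⟨{.east, .west, .north, .south}, fun d => by cases d <;> simp⟩

instance : Fintype Outcome :=
  ⟨{.follow, .mistake .east, .mistake .west, .mistake .north, .mistake .south}, fun o => by
    rcases o with _ | d
    · simp
    · cases d <;> simp⟩

theorem sum_dir (φ : Dir → ℝ) :
    ∑ d, φ d = φ .east + φ .west + φ .north + φ .south := by
  change ∑ d ∈ ({.east, .west, .north, .south} : Finset Dir), φ d = _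
  repeat rw [Finset.sum_insert (by simp)]
  rw [Finset.sum_singleton]
  ring

/-- The probability of an outcome, when mistakes have probability `p`. -/
noncomputable def outcomeProb (p : ℝ) : Outcome → ℝ
  | .follow => 1 - p
  | .mistake _ => p / 4

/-- The mean of a function of one outcome. -/
noncomputable def outcomeMean (p : ℝ) (φ : Outcome → ℝ) : ℝ := ∑ o, outcomeProb p o * φ o

theorem outcomeMean_eq (p : ℝ) (φ : Outcome → ℝ) :
    outcomeMean p φ = (1 - p) * φ .follow + p / 4 * φ (.mistake .east) +
      p / 4 * φ (.mistake .west) + p / 4 * φ (.mistake .north) + p / 4 * φ (.mistake .south) := by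
  change ∑ o ∈ ({.follow, .mistake .east, .mistake .west, .mistake .north, .mistake .south} :
    Finset Outcome), outcomeProb p o * φ o = _
  repeat rw [Finset.sum_insert (by simp)]
  rw [Finset.sum_singleton]
  simp only [outcomeProb]
  ring

theorem outcomeProb_nonneg {p : ℝ} (hp : 0 ≤ p) (hp1 : p ≤ 1) (o : Outcome) :
    0 ≤ outcomeProb p o := by
  cases o <;> simp only [outcomeProb] <;> linarith

theorem outcomeMean_mono {p : ℝ} (hp : 0 ≤ p) (hp1 : p ≤ 1) {φ ψ : Outcome → ℝ}
    (h : ∀ o, φ o ≤ ψ o) : outcomeMean p φ ≤ outcomeMean p ψ :=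
  Finset.sum_le_sum fun o _ => mul_le_mul_of_nonneg_left (h o) (outcomeProb_nonneg hp hp1 o)

theorem outcomeMean_const (p c : ℝ) : outcomeMean p (fun _ => c) = c := by
  rw [outcomeMean_eq]; ring

theorem outcomeMean_mul_left (p c : ℝ) (φ : Outcome → ℝ) :
    outcomeMean p (fun o => c * φ o) = c * outcomeMean p φ := by
  simp only [outcomeMean_eq]; ring

/-- The mean of a function of a word of `n` independent outcomes. -/
noncomputable def wordMean (p : ℝ) : ℕ → (List Outcome → ℝ) → ℝ
  | 0, φ => φ []
  | n + 1, φ => outcomeMean p fun o => wordMean p n fun w => φ (o :: w)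

section WordMean

variable {p : ℝ}

theorem wordMean_mono (hp : 0 ≤ p) (hp1 : p ≤ 1) {n : ℕ} {φ ψ : List Outcome → ℝ}
    (h : ∀ w, w.length = n → φ w ≤ ψ w) : wordMean p n φ ≤ wordMean p n ψ := by
  induction n generalizing φ ψ with
  | zero => exact h [] rfl
  | succ n ih =>
    exact outcomeMean_mono hp hp1 fun o => ih fun w hw => h _ (by simp [hw])

theorem wordMean_congr {n : ℕ} {φ ψ : List Outcome → ℝ}
    (h : ∀ w, w.length = n → φ w = ψ w) : wordMean p n φ = wordMean p n ψ := by
  induction n generalizing φ ψ with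
  | zero => exact h [] rfl
  | succ n ih =>
    simp only [wordMean]
    congr 1
    funext o
    exact ih fun w hw => h _ (by simp [hw])

theorem wordMean_const (n : ℕ) (c : ℝ) : wordMean p n (fun _ => c) = c := by
  induction n with
  | zero => rfl
  | succ n ih => simp only [wordMean, ih, outcomeMean_const]

theorem wordMean_mul_left (n : ℕ) (c : ℝ) (φ : List Outcome → ℝ) :
    wordMean p n (fun w => c * φ w) = c * wordMean p n φ := by
  induction n generalizing φ with
  | zero => rfl
  | succ n ih => simp only [wordMean, ih, outcomeMean_mul_left]

theorem wordMean_sum {ι : Type*} (s : Finset ι) (n : ℕ) (φ : ι → List Outcome → ℝ) :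
    wordMean p n (fun w => ∑ i ∈ s, φ i w) = ∑ i ∈ s, wordMean p n (φ i) := by
  induction n generalizing φ with
  | zero => rfl
  | succ n ih =>
    simp only [wordMean, ih, outcomeMean, Finset.mul_sum]
    rw [Finset.sum_comm]

theorem wordMean_sub (n : ℕ) (φ ψ : List Outcome → ℝ) :
    wordMean p n (fun w => φ w - ψ w) = wordMean p n φ - wordMean p n ψ := by
  induction n generalizing φ ψ with
  | zero => rfl
  | succ n ih =>
    simp only [wordMean, ih, outcomeMean_eq]
    ring

theorem wordMean_append (m n : ℕ) (φ : List Outcome → ℝ) :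
    wordMean p (m + n) φ = wordMean p m fun u => wordMean p n fun v => φ (u ++ v) := by
  induction m generalizing φ with
  | zero => simp only [wordMean, Nat.zero_add, List.nil_append]
  | succ m ih =>
    rw [Nat.add_right_comm]
    simp only [wordMean, ih, List.cons_append]

theorem wordMean_take {k n : ℕ} (hk : k ≤ n) (φ : List Outcome → ℝ) :
    wordMean p n (fun w => φ (w.take k)) = wordMean p k φ := by
  obtain ⟨m, rfl⟩ := Nat.exists_eq_add_of_le hk
  rw [wordMean_append]
  refine wordMean_congr fun u hu => ?_
  rw [wordMean_congr (ψ := fun _ => φ u), wordMean_const]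
  intro v _
  rw [List.take_append_of_le_length hu.ge, List.take_of_length_le hu.le]

end WordMean

/-! ### The agent's displacement under a list of instructions -/

/-- The move of the agent for a given instruction and a given outcome. -/
def step (d : Dir) : Outcome → ℤ × ℤ
  | .follow => d.vec
  | .mistake d' => d'.vec

/-- The displacement of an agent that is given the instructions `l` when the outcomes are `w`. -/
def agentDisp (l : List Dir) (w : List Outcome) : ℤ × ℤ := (List.zipWith step l w).sum

theorem agentDisp_cons (d : Dir) (l : List Dir) (o : Outcome) (w : List Outcome) :
    agentDisp (d :: l) (o :: w) = step d o + agentDisp l w := by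
  simp [agentDisp]

theorem agentDisp_append {l₁ l₂ : List Dir} {w₁ w₂ : List Outcome}
    (h : l₁.length = w₁.length) :
    agentDisp (l₁ ++ l₂) (w₁ ++ w₂) = agentDisp l₁ w₁ + agentDisp l₂ w₂ := by
  rw [agentDisp, List.zipWith_append h, List.sum_append, agentDisp, agentDisp]

theorem displacement_cons (d : Dir) (l : List Dir) :
    displacement (d :: l) = d.vec + displacement l := by
  simp [displacement]

theorem displacement_append (l₁ l₂ : List Dir) :
    displacement (l₁ ++ l₂) = displacement l₁ + displacement l₂ := by
  simp [displacement]

/-- The component of a vector in a cardinal direction. -/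
def Dir.comp (e : Dir) (v : ℤ × ℤ) : ℤ := e.vec.1 * v.1 + e.vec.2 * v.2

theorem Dir.comp_add (e : Dir) (v w : ℤ × ℤ) : e.comp (v + w) = e.comp v + e.comp w := by
  simp only [Dir.comp, Prod.fst_add, Prod.snd_add]; ring

/-- The deviation of a move from its mean, in direction `e`. -/
noncomputable def stepDev (p : ℝ) (e d : Dir) (o : Outcome) : ℝ := e.comp (step d o) - (1 - p) * e.comp d.vec

/-- The variance of a move in direction `e`, given the instruction. -/
noncomputable def stepVar (p : ℝ) (e d : Dir) : ℝ := outcomeMean p fun o => stepDev p e d o ^ 2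

theorem outcomeMean_stepDev (p : ℝ) (e d : Dir) : outcomeMean p (stepDev p e d) = 0 := by
  rw [outcomeMean_eq]
  cases e <;> cases d <;> simp [stepDev, Dir.comp, step, Dir.vec] <;> ring

theorem abs_stepDev_le {p : ℝ} (hp : 0 ≤ p) (hp1 : p ≤ 1) (e d : Dir) (o : Outcome) :
    |stepDev p e d o| ≤ 2 := by
  refine abs_le.mpr ⟨?_, ?_⟩ <;> rcases o with _ | d' <;> cases e <;> cases d <;>
    try cases d'
  all_goals simp [stepDev, Dir.comp, step, Dir.vec] <;> linarith

/-- Whether a direction is vertical. -/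
def Dir.Vertical (d : Dir) : Prop := d = .north ∨ d = .south

instance : DecidablePred Dir.Vertical := fun _ => inferInstanceAs (Decidable (_ ∨ _))

/-- Most moves of a phase are horizontal, so the horizontal and vertical variances per step are
about `p / 2 * (3 - 2 * p)` and `p / 2`. This is the reason for the ratio `A / B = √(3 - 2 * p₀)`.
-/
theorem stepVar_eq (p : ℝ) (e d : Dir) :
    stepVar p e d = if e.Vertical ↔ d.Vertical then p / 2 * (3 - 2 * p) else p / 2 := by
  rw [stepVar, outcomeMean_eq]
  cases e <;> cases d <;>
    simp [stepDev, Dir.comp, step, Dir.vec, Dir.Vertical] <;> ring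

theorem exp_le_cubic {y : ℝ} (hy : |y| ≤ 1) : Real.exp y ≤ 1 + y + y ^ 2 / 2 + |y| ^ 3 := by
  have h := Real.exp_bound hy (n := 3) (by norm_num)
  have h2 := (abs_le.mp h).2
  simp only [Finset.sum_range_succ, Finset.sum_range_zero, Nat.factorial] at h2
  norm_num at h2
  have h3 : (0 : ℝ) ≤ |y| ^ 3 := by positivity
  linarith

/-- Second-order expansion: the linear term has mean zero and the deviation is at most `2`, whence
the error `8 * s ^ 3`. The sharp factor `1 / 2` of the variance is needed for the exponent `a² / 4`;
the cubic error becomes negligible since `s` will tend to `0`. -/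
theorem outcomeMean_exp_le {p s : ℝ} (hp : 0 ≤ p) (hp1 : p ≤ 1) (hs : 0 ≤ s) (hs1 : s ≤ 1 / 2)
    (e d : Dir) :
    outcomeMean p (fun o => Real.exp (s * stepDev p e d o)) ≤
      Real.exp (s ^ 2 * (stepVar p e d / 2 + 8 * s)) := by
  calc outcomeMean p (fun o => Real.exp (s * stepDev p e d o))
      ≤ outcomeMean p (fun o => 1 + s * stepDev p e d o + s ^ 2 / 2 * stepDev p e d o ^ 2
          + 8 * s ^ 3) := by
        refine outcomeMean_mono hp hp1 fun o => ?_
        have h2 := abs_stepDev_le hp hp1 e d o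
        have habs : |s * stepDev p e d o| ≤ 2 * s := by
          rw [abs_mul, abs_of_nonneg hs]; nlinarith
        have h3 : |s * stepDev p e d o| ^ 3 ≤ (2 * s) ^ 3 := by gcongr
        have := exp_le_cubic (habs.trans (by linarith))
        nlinarith
    _ = 1 + s * outcomeMean p (stepDev p e d) + s ^ 2 / 2 * stepVar p e d + 8 * s ^ 3 := by
        simp only [stepVar, outcomeMean_eq]; ring
    _ ≤ _ := by
        rw [outcomeMean_stepDev]
        have := Real.add_one_le_exp (s ^ 2 * (stepVar p e d / 2 + 8 * s))
        linarith

/-- The exponential moments of the deviation of the agent from its mean displacement. -/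
theorem wordMean_exp_le {p s : ℝ} (hp : 0 ≤ p) (hp1 : p ≤ 1) (hs : 0 ≤ s) (hs1 : s ≤ 1 / 2)
    (e : Dir) (l : List Dir) :
    wordMean p l.length (fun w => Real.exp (s * (e.comp (agentDisp l w) -
        (1 - p) * e.comp (displacement l)))) ≤
      Real.exp (s ^ 2 * ((l.map (stepVar p e)).sum / 2 + 8 * s * l.length)) := by
  induction l with
  | nil => simp [wordMean, agentDisp, displacement, Dir.comp]
  | cons d l ih =>
    have hsplit : ∀ o w, Real.exp (s * (e.comp (agentDisp (d :: l) (o :: w)) -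
        (1 - p) * e.comp (displacement (d :: l)))) = Real.exp (s * stepDev p e d o) *
        Real.exp (s * (e.comp (agentDisp l w) - (1 - p) * e.comp (displacement l))) := by
      intro o w
      rw [← Real.exp_add, agentDisp_cons, displacement_cons, Dir.comp_add, Dir.comp_add, stepDev]
      push_cast
      ring_nf
    simp only [List.length_cons, wordMean, hsplit, wordMean_mul_left]
    simp only [mul_comm (Real.exp (s * stepDev p e d _)), outcomeMean_mul_left]
    calc _ ≤ Real.exp (s ^ 2 * ((l.map (stepVar p e)).sum / 2 + 8 * s * l.length)) *
          Real.exp (s ^ 2 * (stepVar p e d / 2 + 8 * s)) := by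
          refine mul_le_mul ih (outcomeMean_exp_le hp hp1 hs hs1 e d) ?_ (Real.exp_pos _).le
          have := outcomeMean_mono hp hp1 (φ := fun _ => 0)
            (ψ := fun o => Real.exp (s * stepDev p e d o)) fun o => (Real.exp_pos _).le
          rwa [outcomeMean_const] at this
      _ = _ := by
          rw [← Real.exp_add]
          simp only [List.map_cons, List.sum_cons]
          push_cast
          ring_nf

/-! ### Two crossing lattice paths meet -/

/-- The signed number of crossings of the half-line `(0, ∞) × {1 / 2}` by the lattice edge
from `f` to `g`. -/
def edgeCrossing (f g : ℤ × ℤ) : ℤ :=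
  if 0 < f.1 ∧ 0 < g.1 then (if 1 ≤ g.2 then 1 else 0) - (if 1 ≤ f.2 then 1 else 0) else 0

/-- `edgeCrossing` is a discrete closed form away from the origin: only a cell with a corner at `0`
can have exactly one of its two vertical sides crossing the half-line. -/
theorem edgeCrossing_cell (f : ℤ × ℤ) (d e : Dir) (h₀ : f ≠ 0) (h₁ : f + d.vec ≠ 0)
    (h₂ : f + e.vec ≠ 0) (h₃ : f + d.vec + e.vec ≠ 0) :
    edgeCrossing f (f + d.vec) + edgeCrossing (f + d.vec) (f + d.vec + e.vec) =
      edgeCrossing f (f + e.vec) + edgeCrossing (f + e.vec) (f + d.vec + e.vec) := by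
  obtain ⟨x, y⟩ := f
  simp only [ne_eq, Prod.ext_iff, Prod.fst_add, Prod.snd_add, Prod.fst_zero, Prod.snd_zero]
    at h₀ h₁ h₂ h₃
  cases d <;> cases e <;>
    simp only [edgeCrossing, Dir.vec, Prod.fst_add, Prod.snd_add] at * <;> grind

/-- A discrete form of the fact that a path from left to right and a path from top to bottom
of a rectangle meet. -/
theorem exists_add_eq_zero {m n : ℕ} {a b : ℕ → ℤ × ℤ}
    (ha : ∀ i < m, ∃ d : Dir, a (i + 1) = a i + d.vec)
    (hb : ∀ j < n, ∃ d : Dir, b (j + 1) = b j + d.vec)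
    (hleft : ∀ j ≤ n, (a 0 + b j).1 < 0) (hright : ∀ j ≤ n, 0 < (a m + b j).1)
    (hbot : ∀ i ≤ m, (a i + b 0).2 < 0) (htop : ∀ i ≤ m, 0 < (a i + b n).2) :
    ∃ i ≤ m, ∃ j ≤ n, a i + b j = 0 := by
  by_contra! hne
  -- If the sums avoid `0`, the number of crossings of the path `j ↦ a i + b j` does not depend on
  -- `i`: by the cell identity its change telescopes to the two ends of the path, which stay below
  -- and above the half-line. At `i = 0` the path is to the left of the half-line.
  have hcol : ∀ i ≤ m, ∑ j ∈ Finset.range n, edgeCrossing (a i + b j) (a i + b (j + 1)) = 0 := by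
    intro i
    induction i with
    | zero =>
      intro _
      refine Finset.sum_eq_zero fun j hj => ?_
      have := hleft j (Finset.mem_range.mp hj).le
      simp only [edgeCrossing]
      rw [if_neg (by omega)]
    | succ i ih =>
      intro hi
      obtain ⟨d, hd⟩ := ha i hi
      have hstep : ∀ j ∈ Finset.range n,
          edgeCrossing (a (i + 1) + b j) (a (i + 1) + b (j + 1)) -
            edgeCrossing (a i + b j) (a i + b (j + 1)) =
          edgeCrossing (a i + b (j + 1)) (a (i + 1) + b (j + 1)) -
            edgeCrossing (a i + b j) (a (i + 1) + b j) := by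
        intro j hj
        rw [Finset.mem_range] at hj
        obtain ⟨e, he⟩ := hb j hj
        have e1 : a (i + 1) + b j = a i + b j + d.vec := by rw [hd]; abel
        have e2 : a i + b (j + 1) = a i + b j + e.vec := by rw [he]; abel
        have e3 : a (i + 1) + b (j + 1) = a i + b j + d.vec + e.vec := by rw [hd, he]; abel
        have := edgeCrossing_cell (a i + b j) d e (hne _ (by omega) _ hj.le)
          (e1 ▸ hne _ hi _ hj.le) (e2 ▸ hne _ (by omega) _ hj) (e3 ▸ hne _ hi _ hj)
        rw [e1, e2, e3]
        linarith
      have hsum := Finset.sum_congr rfl hstep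
      rw [Finset.sum_sub_distrib, ih (by omega),
        Finset.sum_range_sub (fun j => edgeCrossing (a i + b j) (a (i + 1) + b j)), sub_zero] at hsum
      rw [hsum]
      have h1 := hbot i (by omega)
      have h2 := hbot (i + 1) hi
      have h3 := htop i (by omega)
      have h4 := htop (i + 1) hi
      simp only [edgeCrossing]
      rw [if_neg (show ¬ 1 ≤ (a i + b 0).2 by omega),
        if_neg (show ¬ 1 ≤ (a (i + 1) + b 0).2 by omega),
        if_pos (show 1 ≤ (a i + b n).2 by omega), if_pos (show 1 ≤ (a (i + 1) + b n).2 by omega)]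
      simp
  have hm := hcol m le_rfl
  -- At `i = m` the path is entirely to the right, so its crossings telescope to `1`, a
  -- contradiction.
  have hlast : ∀ j ∈ Finset.range n, edgeCrossing (a m + b j) (a m + b (j + 1)) =
      (if 1 ≤ (a m + b (j + 1)).2 then 1 else 0) - (if 1 ≤ (a m + b j).2 then 1 else 0) := by
    intro j hj
    rw [Finset.mem_range] at hj
    rw [edgeCrossing, if_pos ⟨hright j hj.le, hright (j + 1) hj⟩]
  rw [Finset.sum_congr rfl hlast,
    Finset.sum_range_sub (fun j => if 1 ≤ (a m + b j).2 then (1 : ℤ) else 0)] at hm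
  have h1 := hbot m le_rfl
  have h2 := htop m le_rfl
  rw [if_pos (by omega), if_neg (by omega)] at hm
  omega

/-! ### The geometry of a phase -/

theorem displacement_replicate (k : ℕ) (d : Dir) :
    displacement (List.replicate k d) = k • d.vec := by
  simp [displacement]

theorem length_zigzag_succ (w g n : ℕ) :
    (zigzag w g (n + 1)).length = n * (2 * w + g) + 2 * w := by
  induction n with
  | zero => simp [zigzag]
  | succ n ih =>
    rw [zigzag, List.length_append, List.length_append, ih]
    simp only [Nat.add_eq_zero_iff, one_ne_zero, and_false, if_false, List.length_replicate]
    ring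

/-- The appended gap leads to the starting point of line `n` (counted from `0`), which is the form
in which the recursion closes. -/
theorem displacement_zigzag_gap (w g n : ℕ) :
    displacement (zigzag w g n ++ (if n = 0 then [] else List.replicate g Dir.north)) =
      (if Even n then 0 else 2 * (w : ℤ), n * (g : ℤ)) := by
  induction n with
  | zero => simp [zigzag, displacement, Prod.zero_eq_mk]
  | succ n ih =>
    rw [zigzag, displacement_append, displacement_append, ih, displacement_replicate,
      if_neg n.succ_ne_zero, displacement_replicate]
    rcases Nat.even_or_odd n with hn | hn
    · have h1 : ¬ Even (n + 1) := by simpa [Nat.even_add_one] using hn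
      simp [hn, h1, Dir.vec]
      ring
    · have h0 : ¬ Even n := by simpa using hn
      have h1 : Even (n + 1) := hn.add_one
      simp [h0, h1, Dir.vec]
      ring

theorem displacement_take_zigzag (w g n : ℕ) {k j : ℕ} (hk : k < n) (hj : j ≤ 2 * w) :
    displacement ((zigzag w g n).take (k * (2 * w + g) + j)) =
      (if Even k then (j : ℤ) else 2 * w - j, k * (g : ℤ)) := by
  induction n with
  | zero => omega
  | succ n ih =>
    rcases Nat.lt_succ_iff_lt_or_eq.mp hk with hkn | rfl
    · obtain ⟨n, rfl⟩ : ∃ n', n = n' + 1 := ⟨n - 1, by omega⟩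
      have hle : k * (2 * w + g) + j ≤ (zigzag w g (n + 1)).length := by
        rw [length_zigzag_succ]
        have : k * (2 * w + g) ≤ n * (2 * w + g) := Nat.mul_le_mul_right _ (by omega)
        omega
      rw [zigzag, List.append_assoc, List.take_append_of_le_length hle, ih hkn]
    · have hlen : (zigzag w g k ++ (if k = 0 then [] else List.replicate g Dir.north)).length =
          k * (2 * w + g) := by
        rcases k with _ | k
        · simp [zigzag]
        · rw [List.length_append, length_zigzag_succ, if_neg (by omega), List.length_replicate]
          ring
      rw [zigzag, ← hlen, List.take_length_add_append, displacement_append,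
        displacement_zigzag_gap, List.take_replicate, displacement_replicate, min_eq_left hj]
      split_ifs with h <;> simp [Dir.vec]
      ring

/-- Two consecutive lines of a sweep enclose the target or meet it, up to an additional shift:
if an agent following the moves of a sweep with the largest shift always stays close to its mean
position, then for some smaller shift the same moves lead to the target. -/
theorem exists_shift_hit {w h g n M : ℕ} {m δ : ℝ} {x home : ℤ × ℤ} {r : List Dir}
    {ω : List Outcome} (hm : 0 < m) (hg : 0 < g) (hδ : 0 ≤ δ)
    (hω : ω.length = (List.replicate w Dir.west ++ (List.replicate h Dir.south ++
      (List.replicate M Dir.north ++ (zigzag w g n ++ r)))).length)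
    (hdev : ∀ k ≤ ω.length, ∀ e : Dir,
      (e.comp (agentDisp ((List.replicate w Dir.west ++ (List.replicate h Dir.south ++
        (List.replicate M Dir.north ++ (zigzag w g n ++ r)))).take k) (ω.take k)) : ℝ) -
      m * e.comp (displacement ((List.replicate w Dir.west ++ (List.replicate h Dir.south ++
        (List.replicate M Dir.north ++ (zigzag w g n ++ r)))).take k)) ≤ δ)
    (hE : ((x - home).1 : ℝ) + 3 * δ < m * w) (hW : -((x - home).1 : ℝ) + 3 * δ < m * w)
    (hN : ((x - home).2 : ℝ) + 3 * δ < m * h) (hS : -((x - home).2 : ℝ) ≤ m * h)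
    (hn : 2 * h ≤ n * g) (hM : 6 * δ < m * ((M : ℝ) - g)) :
    ∃ z ∈ Finset.Icc 1 M, ∃ s ≤ (zigzag w g n).length,
      x + agentDisp (List.replicate w Dir.west ++ (List.replicate h Dir.south ++
        List.replicate z Dir.north)) (ω.take (w + h + z)) +
      agentDisp ((zigzag w g n).take s) ((ω.drop (w + h + M)).take s) = home := by
  set Z := zigzag w g n with hZ
  set l := List.replicate w Dir.west ++ (List.replicate h Dir.south ++
      (List.replicate M Dir.north ++ (Z ++ r))) with hl
  -- `q` is the trajectory for the largest shift. Smaller shifts are read off from it by skipping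
  -- northward steps.
  set q : ℕ → ℤ × ℤ := fun k => agentDisp (l.take k) (ω.take k) with hq
  have hlenl : l.length = w + h + M + Z.length + r.length := by
    simp [hl]; ring
  -- the instructions
  have htake : ∀ z ≤ M, l.take (w + h + z) = List.replicate w Dir.west ++
      (List.replicate h Dir.south ++ List.replicate z Dir.north) := by
    intro z hz
    have h1 := List.take_length_add_append (l₁ := List.replicate w Dir.west)
      (l₂ := List.replicate h Dir.south ++ (List.replicate M Dir.north ++ (Z ++ r))) (i := h + z)
    have h2 := List.take_length_add_append (l₁ := List.replicate h Dir.south)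
      (l₂ := List.replicate M Dir.north ++ (Z ++ r)) (i := z)
    rw [List.length_replicate] at h1 h2
    rw [add_assoc, hl, h1, h2, List.take_append_of_le_length (by simpa using hz),
      List.take_replicate, min_eq_left hz]
  have htake' : ∀ s ≤ Z.length, l.take (w + h + M + s) =
      (List.replicate w Dir.west ++ (List.replicate h Dir.south ++ List.replicate M Dir.north)) ++
        Z.take s := by
    intro s hs
    have h1 := List.take_length_add_append (l₁ := List.replicate w Dir.west ++
      (List.replicate h Dir.south ++ List.replicate M Dir.north)) (l₂ := Z ++ r) (i := s)
    simp only [List.length_append, List.length_replicate] at h1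
    rw [List.take_append_of_le_length hs] at h1
    rw [← h1, hl]
    simp only [List.append_assoc, add_assoc]
  have hd1 : ∀ z ≤ M, displacement (l.take (w + h + z)) = (-(w : ℤ), -(h : ℤ) + z) := by
    intro z hz
    rw [htake z hz]
    simp [displacement_append, displacement_replicate, Dir.vec]
  have hd2 : ∀ s ≤ Z.length, displacement (l.take (w + h + M + s)) =
      (-(w : ℤ), -(h : ℤ) + M) + displacement (Z.take s) := by
    intro s hs
    rw [htake' s hs, displacement_append]
    simp [displacement_append, displacement_replicate, Dir.vec]
  -- the agent
  have hstep : ∀ k < ω.length, ∃ d : Dir, q (k + 1) = q k + d.vec := by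
    intro k hk
    have hkl : k < l.length := hω ▸ hk
    have h1 : q (k + 1) = q k + step l[k] ω[k] := by
      simp only [hq]
      rw [← List.take_append_getElem hkl, ← List.take_append_getElem hk,
        agentDisp_append (by simp; omega)]
      simp [agentDisp]
    rw [h1]
    rcases ω[k] with _ | d
    · exact ⟨_, rfl⟩
    · exact ⟨d, rfl⟩
  have hq2 : ∀ s ≤ Z.length, q (w + h + M + s) =
      q (w + h + M) + agentDisp (Z.take s) ((ω.drop (w + h + M)).take s) := by
    intro s hs
    have h0 := htake M le_rfl
    simp only [hq]
    rw [List.take_add (l := l), List.take_add (l := ω), agentDisp_append (by simp; omega)]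
    congr 2
    have h1 := htake' s hs
    rw [← h0, List.take_add] at h1
    exact List.append_cancel_left h1
  have hdevE : ∀ k ≤ ω.length, ((q k).1 : ℝ) - m * (displacement (l.take k)).1 ≤ δ := by
    intro k hk
    simpa [Dir.comp, Dir.vec] using hdev k hk .east
  have hdevW : ∀ k ≤ ω.length, -δ ≤ ((q k).1 : ℝ) - m * (displacement (l.take k)).1 := by
    intro k hk
    have := hdev k hk .west
    simp [Dir.comp, Dir.vec] at this
    simp only [hq]
    linarith
  have hdevN : ∀ k ≤ ω.length, ((q k).2 : ℝ) - m * (displacement (l.take k)).2 ≤ δ := by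
    intro k hk
    simpa [Dir.comp, Dir.vec] using hdev k hk .north
  have hdevS : ∀ k ≤ ω.length, -δ ≤ ((q k).2 : ℝ) - m * (displacement (l.take k)).2 := by
    intro k hk
    have := hdev k hk .south
    simp [Dir.comp, Dir.vec] at this
    simp only [hq]
    linarith
  -- the line that will meet the target
  have hgR : (0 : ℝ) < g := by exact_mod_cast hg
  have hnR : 2 * (h : ℝ) ≤ n * g := by exact_mod_cast hn
  set v := x - home with hv
  -- Line `k = ⌈y⌉ - 1` is the last one that passes below the target, with margin `3 * δ`, when
  -- there is no shift; a shift by `M` lifts it above, because `M` exceeds the gap. The margin is `3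
  -- * δ` because three values of `q` enter each comparison.
  set y : ℝ := (m * h - v.2 - 3 * δ) / (m * g) with hy
  have hypos : 0 < y := div_pos (by linarith) (by positivity)
  have hyn : y ≤ n := by
    rw [hy, div_le_iff₀ (by positivity)]
    nlinarith
  obtain ⟨k, hk⟩ : ∃ k, ⌈y⌉₊ = k + 1 := ⟨⌈y⌉₊ - 1, by have := Nat.ceil_pos.mpr hypos; omega⟩
  have hkn : k < n := by have := Nat.ceil_le.mpr hyn; omega
  have hky : (k : ℝ) < y := by
    have := Nat.ceil_lt_add_one hypos.le
    rw [hk] at this; push_cast at this; linarith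
  have hyk : y ≤ k + 1 := by
    have := Nat.le_ceil y
    rw [hk] at this; exact_mod_cast this
  rw [hy, lt_div_iff₀ (by positivity)] at hky
  rw [hy, div_le_iff₀ (by positivity)] at hyk
  obtain ⟨n', rfl⟩ : ∃ n', n = n' + 1 := ⟨n - 1, by omega⟩
  have hZlen : ∀ j ≤ 2 * w, k * (2 * w + g) + j ≤ Z.length := by
    intro j hj
    rw [hZ, length_zigzag_succ]
    have : k * (2 * w + g) ≤ n' * (2 * w + g) := Nat.mul_le_mul_right _ (by omega)
    omega
  -- Lines with odd index run west. They are read backwards, so that the path always goes from left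
  -- to right.
  set σ : ℕ → ℕ := fun i => if Even k then i else 2 * w - i with hσ
  have hσle : ∀ i ≤ 2 * w, σ i ≤ 2 * w := by
    intro i hi; simp only [hσ]; split_ifs <;> omega
  have hdσ : ∀ i ≤ 2 * w, displacement (l.take (w + h + M + (k * (2 * w + g) + σ i))) =
      (-(w : ℤ) + i, -(h : ℤ) + M + k * g) := by
    intro i hi
    rw [hd2 _ (hZlen _ (hσle i hi)), hZ, displacement_take_zigzag w g _ hkn (hσle i hi)]
    simp only [hσ]
    split_ifs with hev
    · simp
    · simp only [Prod.mk_add_mk, Prod.mk.injEq, and_true]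
      push_cast [hi]; ring
  have hd0 := hd2 0 (Nat.zero_le _)
  simp only [add_zero, List.take_zero] at hd0
  have hd0' : displacement (l.take (w + h + M)) = (-(w : ℤ), -(h : ℤ) + M) := by
    rw [hd0]; simp [displacement]
  -- `a` is the displacement since the start of the lines along line `k`, and `b` is the position
  -- relative to the target after `j` steps north. If `a i + b j = 0`, then shift `j` brings the
  -- agent to the target on line `k`. On average `a i` is `m * (i, k * g)` and `b j` is `v + m *
  -- (-w, -h + j)`.
  have hkey := exists_add_eq_zero (m := 2 * w) (n := M)
    (a := fun i => q (w + h + M + (k * (2 * w + g) + σ i)) - q (w + h + M))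
    (b := fun j => q (w + h + j) + v) ?_ ?_ ?_ ?_ ?_ ?_
  · obtain ⟨i, hi, j, hj, hij⟩ := hkey
    refine ⟨j, ?_, k * (2 * w + g) + σ i, hZlen _ (hσle i hi), ?_⟩
    · rw [Finset.mem_Icc]
      refine ⟨?_, hj⟩
      -- Shift `0` is not among the allowed ones, but without a shift the line passes below the
      -- target.
      by_contra hj0
      obtain rfl : j = 0 := by omega
      have b1 := hdevN (w + h + M + (k * (2 * w + g) + σ i))
        (by have := hZlen _ (hσle i hi); omega)
      have b2 := hdevS (w + h + M) (by omega)
      have b3 := hdevN (w + h + 0) (by omega)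
      rw [hdσ i hi] at b1
      rw [hd0'] at b2
      rw [hd1 0 (by omega)] at b3
      have hz := congrArg (fun u : ℤ × ℤ => (u.2 : ℝ)) hij
      simp at hz b1 b2 b3
      nlinarith
    · have hs := hq2 _ (hZlen _ (hσle i hi))
      simp only [hs] at hij
      rw [← htake j hj]
      have : q (w + h + j) = agentDisp (l.take (w + h + j)) (ω.take (w + h + j)) := rfl
      rw [← this]
      have h4 : q (w + h + M) + agentDisp (Z.take (k * (2 * w + g) + σ i))
          ((ω.drop (w + h + M)).take (k * (2 * w + g) + σ i)) - q (w + h + M) +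
          (q (w + h + j) + v) + home = home := by rw [hij, zero_add]
      rw [← h4, hv]
      abel
  · intro i hi
    have hb := hZlen _ (hσle i hi.le)
    have hb' := hZlen _ (hσle (i + 1) hi)
    simp only [hσ] at hb hb' ⊢
    split_ifs with hev
    · rw [if_pos hev] at hb hb'
      obtain ⟨d, hd⟩ := hstep (w + h + M + (k * (2 * w + g) + i)) (by omega)
      refine ⟨d, ?_⟩
      rw [← add_assoc (k * (2 * w + g)), ← add_assoc (w + h + M), hd]
      abel
    · rw [if_neg hev] at hb hb'
      obtain ⟨d, hd⟩ := hstep (w + h + M + (k * (2 * w + g) + (2 * w - (i + 1)))) (by omega)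
      have hneg : ∃ d' : Dir, d'.vec = -d.vec := by
        cases d
        · exact ⟨.west, rfl⟩
        · exact ⟨.east, rfl⟩
        · exact ⟨.south, rfl⟩
        · exact ⟨.north, rfl⟩
      obtain ⟨d', hd'⟩ := hneg
      refine ⟨d', ?_⟩
      have e1 : w + h + M + (k * (2 * w + g) + (2 * w - (i + 1))) + 1 =
        w + h + M + (k * (2 * w + g) + (2 * w - i)) := by omega
      rw [e1] at hd
      rw [hd, hd']
      abel
  · intro j hj
    obtain ⟨d, hd⟩ := hstep (w + h + j) (by omega)
    refine ⟨d, ?_⟩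
    rw [← add_assoc, hd]
    abel
  · intro j hj
    have b1 := hdevE (w + h + M + (k * (2 * w + g) + σ 0))
      (by have := hZlen _ (hσle 0 (by omega)); omega)
    have b2 := hdevW (w + h + M) (by omega)
    have b3 := hdevE (w + h + j) (by omega)
    rw [hdσ 0 (by omega)] at b1
    rw [hd0'] at b2
    rw [hd1 j hj] at b3
    rw [← Int.cast_lt (R := ℝ)]
    simp at b1 b2 b3 ⊢
    linarith
  · intro j hj
    have b1 := hdevW (w + h + M + (k * (2 * w + g) + σ (2 * w)))
      (by have := hZlen _ (hσle (2 * w) le_rfl); omega)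
    have b2 := hdevE (w + h + M) (by omega)
    have b3 := hdevW (w + h + j) (by omega)
    rw [hdσ (2 * w) le_rfl] at b1
    rw [hd0'] at b2
    rw [hd1 j hj] at b3
    rw [← Int.cast_lt (R := ℝ)]
    simp at b1 b2 b3 ⊢
    linarith
  · intro i hi
    have b1 := hdevN (w + h + M + (k * (2 * w + g) + σ i))
      (by have := hZlen _ (hσle i hi); omega)
    have b2 := hdevS (w + h + M) (by omega)
    have b3 := hdevN (w + h + 0) (by omega)
    rw [hdσ i hi] at b1
    rw [hd0'] at b2
    rw [hd1 0 (by omega)] at b3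
    rw [← Int.cast_lt (R := ℝ)]
    simp at b1 b2 b3 ⊢
    nlinarith
  · intro i hi
    have b1 := hdevS (w + h + M + (k * (2 * w + g) + σ i))
      (by have := hZlen _ (hσle i hi); omega)
    have b2 := hdevN (w + h + M) (by omega)
    have b3 := hdevS (w + h + M) (by omega)
    rw [hdσ i hi] at b1
    rw [hd0'] at b2 b3
    rw [← Int.cast_lt (R := ℝ)]
    simp at b1 b2 b3 ⊢
    nlinarith

/-! ### The probability of a hit during a phase -/

open Classical in
/-- The indicator of a proposition. -/
noncomputable def ind (P : Prop) : ℝ := if P then 1 else 0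

theorem ind_of {P : Prop} (h : P) : ind P = 1 := if_pos h

theorem ind_of_not {P : Prop} (h : ¬ P) : ind P = 0 := if_neg h

theorem ind_nonneg (P : Prop) : 0 ≤ ind P := by
  unfold ind; split_ifs <;> norm_num

theorem ind_le_one (P : Prop) : ind P ≤ 1 := by
  unfold ind; split_ifs <;> norm_num

theorem ind_mono {P Q : Prop} (h : P → Q) : ind P ≤ ind Q := by
  by_cases hP : P
  · rw [ind_of hP, ind_of (h hP)]
  · rw [ind_of_not hP]; exact ind_nonneg Q

/-- The agent that starts at `x` and is given the instructions `l` visits `home`. -/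
def Hits (x home : ℤ × ℤ) (l : List Dir) (w : List Outcome) : Prop :=
  ∃ k ≤ l.length, x + agentDisp (l.take k) (w.take k) = home

/-- The instructions of a sweep with shift `z` that ends with the moves `r`. -/
def sweepMoves (w h g n M z : ℕ) (r : List Dir) : List Dir :=
  List.replicate w Dir.west ++ (List.replicate h Dir.south ++
    (List.replicate z Dir.north ++ (zigzag w g n ++ (List.replicate (M - z) Dir.north ++ r))))

theorem length_sweepMoves (w h g n M z : ℕ) (r : List Dir) :
    (sweepMoves w h g n M z r).length =
      w + h + z + ((M - z) + ((zigzag w g n).length + r.length)) := by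
  simp [sweepMoves]; omega

theorem stepVar_le_one {p : ℝ} (hp : 0 ≤ p) (hp1 : p ≤ 1) (e d : Dir) : stepVar p e d ≤ 1 := by
  rw [stepVar_eq]
  split_ifs
  · nlinarith [sq_nonneg (p - 1)]
  · linarith

theorem sum_stepVar_le {p c : ℝ} {e : Dir} {l : List Dir} (h : ∀ d, stepVar p e d ≤ c) :
    (l.map (stepVar p e)).sum ≤ c * l.length := by
  induction l with
  | nil => simp
  | cons d l ih =>
    simp only [List.map_cons, List.sum_cons, List.length_cons]
    push_cast
    linarith [h d]

/-- The outcomes of the steps between the shift and the lines, and of those after the lines,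
do not matter for a visit to `home` during the lines. -/
theorem wordMean_visit_le {p : ℝ} (hp : 0 ≤ p) (hp1 : p ≤ 1) {w h g n M z L : ℕ}
    (hz : z ≤ M) (x home : ℤ × ℤ) (r : List Dir)
    (hL : L = w + h + z + ((M - z) + ((zigzag w g n).length + r.length))) :
    wordMean p L (fun ω => ind (∃ s ≤ (zigzag w g n).length,
      x + agentDisp (List.replicate w Dir.west ++ (List.replicate h Dir.south ++
        List.replicate z Dir.north)) (ω.take (w + h + z)) +
      agentDisp ((zigzag w g n).take s) ((ω.drop (w + h + M)).take s) = home)) ≤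
    wordMean p L (fun ω => ind (Hits x home (sweepMoves w h g n M z r) ω)) := by
  set Z := zigzag w g n with hZ
  set pre := List.replicate w Dir.west ++ (List.replicate h Dir.south ++
        List.replicate z Dir.north) with hpre
  have hprelen : pre.length = w + h + z := by simp [hpre]; ring
  -- The sweep with shift `z` consumes the outcomes of the lines directly after step `w + h + z`,
  -- whereas the event reads them from step `w + h + M` on. Both sides reduce to means over an
  -- independent prefix `u` and line word `t`, so the position of the block is irrelevant.
  have hleft : wordMean p L (fun ω => ind (∃ s ≤ Z.length,
      x + agentDisp pre (ω.take (w + h + z)) +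
      agentDisp (Z.take s) ((ω.drop (w + h + M)).take s) = home)) =
      wordMean p (w + h + z) fun u => wordMean p Z.length fun t =>
        ind (∃ s ≤ Z.length, x + agentDisp pre u + agentDisp (Z.take s) (t.take s) = home) := by
    rw [hL, wordMean_append]
    refine wordMean_congr fun u hu => ?_
    rw [wordMean_append]
    rw [wordMean_congr (ψ := fun _ => wordMean p Z.length fun t =>
        ind (∃ s ≤ Z.length, x + agentDisp pre u + agentDisp (Z.take s) (t.take s) = home)),
      wordMean_const]
    intro v hv
    rw [wordMean_append]
    refine wordMean_congr fun t ht => ?_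
    rw [wordMean_congr (ψ := fun _ =>
        ind (∃ s ≤ Z.length, x + agentDisp pre u + agentDisp (Z.take s) (t.take s) = home)),
      wordMean_const]
    intro y _
    have h1 : (u ++ (v ++ (t ++ y))).take (w + h + z) = u := by
      rw [List.take_append_of_le_length hu.ge, List.take_of_length_le hu.le]
    have h2 : (u ++ (v ++ (t ++ y))).drop (w + h + M) = t ++ y := by
      rw [← List.append_assoc, List.drop_append_of_le_length (by simp; omega),
        List.drop_of_length_le (by simp; omega), List.nil_append]
    rw [h1, h2]
    congr 1
    refine propext (exists_congr fun s => and_congr_right fun hs => ?_)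
    rw [List.take_append_of_le_length (by omega)]
  rw [hleft, show L = w + h + z + (Z.length + ((M - z) + r.length)) by omega,
    wordMean_append (w + h + z) (Z.length + ((M - z) + r.length))]
  refine wordMean_mono hp hp1 fun u hu => ?_
  rw [wordMean_append]
  refine wordMean_mono hp hp1 fun t ht => ?_
  rw [← wordMean_const (p := p) (M - z + r.length)
    (ind (∃ s ≤ Z.length, x + agentDisp pre u + agentDisp (Z.take s) (t.take s) = home))]
  refine wordMean_mono hp hp1 fun y _ => ind_mono ?_
  rintro ⟨s, hs, hhome⟩
  refine ⟨w + h + z + s, ?_, ?_⟩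
  · rw [length_sweepMoves, ← hZ]; omega
  · have h1 : (sweepMoves w h g n M z r).take (w + h + z + s) = pre ++ Z.take s := by
      have h2 : sweepMoves w h g n M z r =
          pre ++ (Z ++ (List.replicate (M - z) Dir.north ++ r)) := by
        simp only [sweepMoves, hpre, List.append_assoc, hZ]
      rw [h2, ← hprelen, List.take_length_add_append, List.take_append_of_le_length hs]
    have h2 : (u ++ (t ++ y)).take (w + h + z + s) = u ++ t.take s := by
      rw [← hu, List.take_length_add_append, List.take_append_of_le_length (by omega)]
    rw [h1, h2, agentDisp_append (by omega), ← add_assoc, hhome]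

/-- The probability that an agent deviates from its mean position by more than `δ`. -/
theorem one_sub_le_wordMean_close {p s δ : ℝ} (hp : 0 ≤ p) (hp1 : p ≤ 1) (hs : 0 ≤ s)
    (hs1 : s ≤ 1 / 2) (l : List Dir) :
    1 - 4 * (l.length + 1) * Real.exp (-s * δ + 5 * s ^ 2 * l.length) ≤
    wordMean p l.length (fun ω => ind (∀ k ≤ l.length, ∀ e : Dir,
      (e.comp (agentDisp (l.take k) (ω.take k)) : ℝ) -
        (1 - p) * e.comp (displacement (l.take k)) ≤ δ)) := by
  have hterm : ∀ k ∈ Finset.range (l.length + 1), ∀ e : Dir,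
      wordMean p l.length (fun ω => Real.exp (s * ((e.comp (agentDisp (l.take k) (ω.take k)) : ℝ) -
        (1 - p) * e.comp (displacement (l.take k)) - δ))) ≤
      Real.exp (-s * δ + 5 * s ^ 2 * l.length) := by
    intro k hk e
    rw [Finset.mem_range] at hk
    have hk' : k ≤ l.length := by omega
    have hlen : (l.take k).length = k := by simpa using hk'
    have h1 := wordMean_exp_le hp hp1 hs hs1 e (l.take k)
    rw [hlen] at h1
    have h2 : wordMean p l.length (fun ω => Real.exp (s *
        ((e.comp (agentDisp (l.take k) (ω.take k)) : ℝ) -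
        (1 - p) * e.comp (displacement (l.take k)) - δ))) = Real.exp (-s * δ) *
        wordMean p k (fun ω => Real.exp (s * ((e.comp (agentDisp (l.take k) ω) : ℝ) -
        (1 - p) * e.comp (displacement (l.take k))))) := by
      rw [← wordMean_take hk', ← wordMean_mul_left]
      refine wordMean_congr fun ω _ => ?_
      rw [← Real.exp_add]
      ring_nf
    rw [h2, Real.exp_add]
    refine mul_le_mul_of_nonneg_left (h1.trans (Real.exp_le_exp.mpr ?_)) (Real.exp_pos _).le
    have h3 := sum_stepVar_le (l := l.take k) (e := e) (stepVar_le_one hp hp1 e)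
    rw [hlen] at h3
    have hkR : (k : ℝ) ≤ l.length := by exact_mod_cast hk'
    have hk0 : (0 : ℝ) ≤ k := by positivity
    -- The variance per step is at most `1` and `s ≤ 1 / 2`, so `1 / 2 + 8 * s ≤ 9 / 2 ≤ 5`.
    calc _ ≤ s ^ 2 * (5 * l.length) := by gcongr; nlinarith
      _ = _ := by ring
  -- A union bound over four directions and `l.length + 1` times, with Markov's inequality for the
  -- exponential moments.
  calc 1 - 4 * (l.length + 1) * Real.exp (-s * δ + 5 * s ^ 2 * l.length)
      ≤ 1 - ∑ k ∈ Finset.range (l.length + 1), ∑ e : Dir, wordMean p l.length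
          (fun ω => Real.exp (s * ((e.comp (agentDisp (l.take k) (ω.take k)) : ℝ) -
          (1 - p) * e.comp (displacement (l.take k)) - δ))) := by
        have h1 := Finset.sum_le_sum fun k hk =>
          Finset.sum_le_sum fun (e : Dir) (_ : e ∈ Finset.univ) => hterm k hk e
        simp only [Finset.sum_const, Finset.card_range, nsmul_eq_mul] at h1
        have h2 : (Finset.univ : Finset Dir).card = 4 := rfl
        rw [h2] at h1
        push_cast at h1
        linarith
    _ = wordMean p l.length (fun ω => 1 - ∑ k ∈ Finset.range (l.length + 1), ∑ e : Dir,
          Real.exp (s * ((e.comp (agentDisp (l.take k) (ω.take k)) : ℝ) -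
          (1 - p) * e.comp (displacement (l.take k)) - δ))) := by
        rw [wordMean_sub, wordMean_const, wordMean_sum]
        simp only [wordMean_sum]
    _ ≤ _ := by
        refine wordMean_mono hp hp1 fun ω _ => ?_
        by_cases hω : ∀ k ≤ l.length, ∀ e : Dir,
          (e.comp (agentDisp (l.take k) (ω.take k)) : ℝ) -
            (1 - p) * e.comp (displacement (l.take k)) ≤ δ
        · rw [ind_of hω]
          have : 0 ≤ ∑ k ∈ Finset.range (l.length + 1), ∑ e : Dir,
            Real.exp (s * ((e.comp (agentDisp (l.take k) (ω.take k)) : ℝ) -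
              (1 - p) * e.comp (displacement (l.take k)) - δ)) := by positivity
          linarith
        · rw [ind_of_not hω]
          push Not at hω
          obtain ⟨k, hk, e, hke⟩ := hω
          have h1 : 1 ≤ Real.exp (s * ((e.comp (agentDisp (l.take k) (ω.take k)) : ℝ) -
              (1 - p) * e.comp (displacement (l.take k)) - δ)) :=
            Real.one_le_exp (mul_nonneg hs (by linarith))
          have h2 := Finset.single_le_sum (f := fun k => ∑ e : Dir,
            Real.exp (s * ((e.comp (agentDisp (l.take k) (ω.take k)) : ℝ) -
              (1 - p) * e.comp (displacement (l.take k)) - δ)))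
            (fun k _ => by positivity) (Finset.mem_range.mpr (Nat.lt_succ_of_le hk))
          have h3 := Finset.single_le_sum (f := fun e : Dir =>
            Real.exp (s * ((e.comp (agentDisp (l.take k) (ω.take k)) : ℝ) -
              (1 - p) * e.comp (displacement (l.take k)) - δ)))
            (fun e _ => by positivity) (Finset.mem_univ e)
          linarith

/-- The hitting probabilities of the sweeps with shifts `1, …, M` add up to almost `1`. -/
theorem one_sub_le_sum_wordMean_hits {p s δ : ℝ} (hp : 0 ≤ p) (hp1 : p < 1) (hs : 0 ≤ s)
    (hs1 : s ≤ 1 / 2) {w h g n M L : ℕ} {x home : ℤ × ℤ} (r : ℕ → List Dir)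
    (hg : 0 < g) (hδ : 0 ≤ δ)
    (hL : ∀ z ≤ M, (sweepMoves w h g n M z (r z)).length = L)
    (hE : ((x - home).1 : ℝ) + 3 * δ < (1 - p) * w)
    (hW : -((x - home).1 : ℝ) + 3 * δ < (1 - p) * w)
    (hN : ((x - home).2 : ℝ) + 3 * δ < (1 - p) * h) (hS : -((x - home).2 : ℝ) ≤ (1 - p) * h)
    (hn : 2 * h ≤ n * g) (hM : 6 * δ < (1 - p) * ((M : ℝ) - g)) :
    1 - 4 * (L + 1) * Real.exp (-s * δ + 5 * s ^ 2 * L) ≤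
    ∑ z ∈ Finset.Icc 1 M,
      wordMean p L (fun ω => ind (Hits x home (sweepMoves w h g n M z (r z)) ω)) := by
  have hclose := one_sub_le_wordMean_close hp hp1.le hs hs1 (δ := δ)
    (sweepMoves w h g n M M (r M))
  rw [hL M le_rfl] at hclose
  refine hclose.trans ?_
  -- When the agent stays close to its mean, at least one shift succeeds. The sum of the
  -- probabilities is the mean number of successful shifts, so no independence between the shifts is
  -- needed.
  calc _ ≤ wordMean p L (fun ω => ∑ z ∈ Finset.Icc 1 M,
        ind (∃ s ≤ (zigzag w g n).length,
      x + agentDisp (List.replicate w Dir.west ++ (List.replicate h Dir.south ++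
        List.replicate z Dir.north)) (ω.take (w + h + z)) +
      agentDisp ((zigzag w g n).take s) ((ω.drop (w + h + M)).take s) = home)) := by
        refine wordMean_mono hp hp1.le fun ω hω => ?_
        by_cases hP : ∀ k ≤ L, ∀ e : Dir,
          (e.comp (agentDisp ((sweepMoves w h g n M M (r M)).take k) (ω.take k)) : ℝ) -
            (1 - p) * e.comp (displacement ((sweepMoves w h g n M M (r M)).take k)) ≤ δ
        · rw [ind_of hP]
          rw [← hω] at hP
          have hlist : sweepMoves w h g n M M (r M) = List.replicate w Dir.west ++
              (List.replicate h Dir.south ++ (List.replicate M Dir.north ++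
                (zigzag w g n ++ r M))) := by
            simp [sweepMoves]
          have hlen := hL M le_rfl
          rw [hlist] at hP hlen
          obtain ⟨z, hz, hex⟩ := exists_shift_hit (sub_pos.mpr hp1) hg hδ (hω.trans hlen.symm) hP
            hE hW hN hS hn hM
          refine le_trans (ind_of hex).ge ?_
          exact Finset.single_le_sum (f := fun z => ind (∃ s ≤ (zigzag w g n).length,
            x + agentDisp (List.replicate w Dir.west ++ (List.replicate h Dir.south ++
              List.replicate z Dir.north)) (ω.take (w + h + z)) +
            agentDisp ((zigzag w g n).take s) ((ω.drop (w + h + M)).take s) = home))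
            (fun z _ => ind_nonneg _) hz
        · rw [ind_of_not hP]
          exact Finset.sum_nonneg fun z _ => ind_nonneg _
    _ = ∑ z ∈ Finset.Icc 1 M, wordMean p L (fun ω =>
        ind (∃ s ≤ (zigzag w g n).length,
      x + agentDisp (List.replicate w Dir.west ++ (List.replicate h Dir.south ++
        List.replicate z Dir.north)) (ω.take (w + h + z)) +
      agentDisp ((zigzag w g n).take s) ((ω.drop (w + h + M)).take s) = home)) := wordMean_sum _ _ _
    _ ≤ _ := by
        refine Finset.sum_le_sum fun z hz => ?_
        have hzM := (Finset.mem_Icc.mp hz).2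
        refine wordMean_visit_le hp hp1.le hzM x home (r z) ?_
        rw [← hL z hzM, length_sweepMoves]

/-! ### The length of a phase and its vertical moves -/

/-- The number of vertical moves in a list. -/
def verticalCount (l : List Dir) : ℕ := l.countP fun d => decide d.Vertical

theorem verticalCount_append (l₁ l₂ : List Dir) :
    verticalCount (l₁ ++ l₂) = verticalCount l₁ + verticalCount l₂ := List.countP_append ..

theorem verticalCount_replicate_horizontal (k : ℕ) {d : Dir} (hd : ¬ d.Vertical) :
    verticalCount (List.replicate k d) = 0 := by
  simp [verticalCount, List.countP_replicate, hd]

theorem verticalCount_replicate_le (k : ℕ) (d : Dir) :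
    verticalCount (List.replicate k d) ≤ k :=
  List.countP_le_length.trans_eq (List.length_replicate ..)

theorem natAbs_displacement_snd_le (l : List Dir) :
    (displacement l).2.natAbs ≤ verticalCount l := by
  induction l with
  | nil => simp [displacement]
  | cons d l ih =>
    rw [displacement_cons, verticalCount, List.countP_cons]
    rw [verticalCount] at ih
    refine (Int.natAbs_add_le _ _).trans ?_
    cases d <;> simp [Dir.vec, Dir.Vertical] at * <;> omega

theorem verticalCount_zigzag_le (w g n : ℕ) : verticalCount (zigzag w g n) ≤ n * g := by
  induction n with
  | zero => simp [zigzag, verticalCount]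
  | succ n ih =>
    rw [zigzag, verticalCount_append, verticalCount_append, verticalCount_replicate_horizontal]
    · have : verticalCount (if n = 0 then [] else List.replicate g Dir.north) ≤ g := by
        split_ifs
        · simp [verticalCount]
        · exact verticalCount_replicate_le _ _
      rw [add_mul]; omega
    · split_ifs <;> simp [Dir.Vertical]

theorem length_zigzag_le (w g n : ℕ) : (zigzag w g n).length ≤ 2 * w * n + n * g := by
  rcases n with _ | n
  · simp [zigzag]
  · rw [length_zigzag_succ]; nlinarith

theorem le_length_zigzag (w g n : ℕ) : 2 * w * n ≤ (zigzag w g n).length := by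
  rcases n with _ | n
  · simp
  · rw [length_zigzag_succ]; nlinarith

theorem displacement_zigzag_fst (w g n : ℕ) :
    (displacement (zigzag w g n)).1 = if Even n then 0 else 2 * (w : ℤ) := by
  have h := congrArg Prod.fst (displacement_zigzag_gap w g n)
  rw [displacement_append, Prod.fst_add] at h
  have h2 : (displacement (if n = 0 then [] else List.replicate g Dir.north)).1 = 0 := by
    split_ifs
    · simp [displacement]
    · simp [displacement_replicate, Dir.vec]
  rw [h2, add_zero] at h
  exact h

section Phase

variable (p₀ A B : ℝ)

theorem phase_eq_sweepMoves (t z : ℕ) : phase p₀ A B t z =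
    sweepMoves (boxW p₀ A t) (boxH p₀ B t) (gap p₀ t) (numLines p₀ B t) (maxShift p₀ t) z
      (straight (-displacement (sweep p₀ A B t z))) := by
  simp only [phase, sweep, sweepMoves, List.append_assoc]

theorem natAbs_displacement_sweep_fst (t z : ℕ) :
    (displacement (sweep p₀ A B t z)).1.natAbs = boxW p₀ A t := by
  simp only [sweep, displacement_append, displacement_replicate, Prod.fst_add,
    displacement_zigzag_fst, Dir.vec]
  split_ifs <;> simp
  omega

theorem verticalCount_sweep_le (t z : ℕ) (hz : z ≤ maxShift p₀ t) :
    verticalCount (sweep p₀ A B t z) ≤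
      boxH p₀ B t + maxShift p₀ t + numLines p₀ B t * gap p₀ t := by
  simp only [sweep, verticalCount_append]
  rw [verticalCount_replicate_horizontal _ (by simp [Dir.Vertical])]
  have h1 := verticalCount_replicate_le (boxH p₀ B t) Dir.south
  have h2 := verticalCount_replicate_le z Dir.north
  have h3 := verticalCount_replicate_le (maxShift p₀ t - z) Dir.north
  have h4 := verticalCount_zigzag_le (boxW p₀ A t) (gap p₀ t) (numLines p₀ B t)
  omega

theorem verticalCount_phase_le (t z : ℕ) (hz : z ≤ maxShift p₀ t) :
    verticalCount (phase p₀ A B t z) ≤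
      2 * (boxH p₀ B t + maxShift p₀ t + numLines p₀ B t * gap p₀ t) := by
  rw [phase, verticalCount_append, straight, verticalCount_append,
    verticalCount_replicate_horizontal (Int.natAbs _) (by split_ifs <;> simp [Dir.Vertical])]
  have h1 := verticalCount_sweep_le p₀ A B t z hz
  have h2 := natAbs_displacement_snd_le (sweep p₀ A B t z)
  have h3 := verticalCount_replicate_le (-displacement (sweep p₀ A B t z)).2.natAbs
    (if 0 ≤ (-displacement (sweep p₀ A B t z)).2 then Dir.north else Dir.south)
  rw [Prod.snd_neg, Int.natAbs_neg] at h3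
  rw [Prod.snd_neg, Int.natAbs_neg]
  omega

theorem phaseLength_le (t : ℕ) : phaseLength p₀ A B t ≤
    2 * boxW p₀ A t * numLines p₀ B t + (2 * boxW p₀ A t +
      2 * (boxH p₀ B t + maxShift p₀ t + numLines p₀ B t * gap p₀ t)) := by
  rw [phaseLength, phase, List.length_append, straight, List.length_append,
    List.length_replicate, List.length_replicate, Prod.fst_neg, Prod.snd_neg, Int.natAbs_neg,
    Int.natAbs_neg, natAbs_displacement_sweep_fst]
  have h1 := verticalCount_sweep_le p₀ A B t 0 (Nat.zero_le _)
  have h2 := natAbs_displacement_snd_le (sweep p₀ A B t 0)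
  have h3 := length_zigzag_le (boxW p₀ A t) (gap p₀ t) (numLines p₀ B t)
  simp only [sweep, List.length_append, List.length_replicate] at *
  omega

theorem le_phaseLength (t : ℕ) :
    2 * boxW p₀ A t * numLines p₀ B t ≤ phaseLength p₀ A B t := by
  have h3 := le_length_zigzag (boxW p₀ A t) (gap p₀ t) (numLines p₀ B t)
  simp only [phaseLength, phase, sweep, List.length_append, List.length_replicate]
  omega

theorem displacement_phase (t z : ℕ) : displacement (phase p₀ A B t z) = 0 := by
  have hs : ∀ v : ℤ × ℤ, displacement (straight v) = v := by
    intro v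
    simp only [straight, displacement_append, displacement_replicate]
    ext
    · split_ifs <;> simp [Dir.vec] <;>
        first | omega | (rw [abs_of_neg (by omega)]; omega)
    · split_ifs <;> simp [Dir.vec] <;>
        first | omega | (rw [abs_of_neg (by omega)]; omega)
  rw [phase, displacement_append, hs, add_neg_cancel]

/-- The crude bound `1` for vertical moves is affordable, since they are a vanishing proportion of a
phase. -/
theorem sum_stepVar_vertical_le {p : ℝ} (hp : 0 ≤ p) (hp1 : p ≤ 1) {e : Dir} (he : e.Vertical)
    (l : List Dir) : (l.map (stepVar p e)).sum ≤ p / 2 * l.length + verticalCount l := by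
  induction l with
  | nil => simp [verticalCount]
  | cons d l ih =>
    simp only [List.map_cons, List.sum_cons, List.length_cons, verticalCount, List.countP_cons]
    rw [verticalCount] at ih
    have h1 := stepVar_le_one hp hp1 e d
    have h2 := stepVar_eq p e d
    by_cases hd : d.Vertical
    · simp only [hd, decide_true, if_true]
      push_cast
      linarith
    · simp only [hd, he, iff_false, not_true, if_false] at h2
      simp only [hd, decide_false]
      push_cast
      simp
      linarith

/-! ### Asymptotics -/

theorem tendsto_sqrt_nat : Tendsto (fun t : ℕ => √(t : ℝ)) atTop atTop :=
  Real.tendsto_sqrt_atTop.comp tendsto_natCast_atTop_atTop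

theorem tendsto_log_nat : Tendsto (fun t : ℕ => Real.log t) atTop atTop :=
  Real.tendsto_log_atTop.comp tendsto_natCast_atTop_atTop

theorem tendsto_log_div_rpow {r : ℝ} (hr : 0 < r) :
    Tendsto (fun t : ℕ => Real.log t / (t : ℝ) ^ r) atTop (nhds 0) :=
  ((isLittleO_log_rpow_atTop hr).tendsto_div_nhds_zero).comp tendsto_natCast_atTop_atTop

theorem tendsto_log_div_sqrt :
    Tendsto (fun t : ℕ => Real.log t / √(t : ℝ)) atTop (nhds 0) := by
  simpa only [Real.sqrt_eq_rpow] using tendsto_log_div_rpow (r := 1 / 2) (by norm_num)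

theorem eventually_pos_nat : ∀ᶠ t : ℕ in atTop, 0 < √(t : ℝ) ∧ 0 < Real.log t ∧ (0 : ℝ) < t := by
  filter_upwards [tendsto_sqrt_nat.eventually_gt_atTop 0, tendsto_log_nat.eventually_gt_atTop 0,
    eventually_gt_atTop 0] with t h1 h2 h3
  exact ⟨h1, h2, by exact_mod_cast h3⟩

theorem tendsto_sqrt_div_log :
    Tendsto (fun t : ℕ => √(t : ℝ) / Real.log t) atTop atTop := by
  have h : Tendsto (fun t : ℕ => (Real.log t / √(t : ℝ))⁻¹) atTop atTop := by
    refine Tendsto.inv_tendsto_nhdsGT_zero ?_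
    refine tendsto_nhdsWithin_iff.mpr ⟨tendsto_log_div_sqrt, ?_⟩
    filter_upwards [eventually_pos_nat] with t ht
    exact div_pos ht.2.1 ht.1
  simpa using h

variable {p₀ A B}

theorem tendsto_boxW (hp₀' : p₀ < 1) (hA : 0 < A) :
    Tendsto (fun t : ℕ => (boxW p₀ A t : ℝ) / √(t : ℝ)) atTop (nhds (A / (1 - p₀))) := by
  have h1 : 0 ≤ 1 / (1 - p₀) * A := by have := sub_pos.mpr hp₀'; positivity
  have h := (tendsto_nat_ceil_mul_div_atTop (R := ℝ) h1).comp tendsto_sqrt_nat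
  rw [show A / (1 - p₀) = 1 / (1 - p₀) * A by ring]
  exact h

theorem tendsto_gap (hp₀' : p₀ < 1) :
    Tendsto (fun t : ℕ => (gap p₀ t : ℝ) / (√(t : ℝ) / Real.log t)) atTop
      (nhds (1 / (1 - p₀))) := by
  have h1 : 0 ≤ 1 / (1 - p₀) := by have := sub_pos.mpr hp₀'; positivity
  exact (tendsto_nat_ceil_mul_div_atTop (R := ℝ) h1).comp tendsto_sqrt_div_log

/-- The extra `t ^ (1/3)` in the shift range absorbs the random deviations, but is negligible
compared with the gap. -/
theorem tendsto_maxShift (hp₀' : p₀ < 1) :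
    Tendsto (fun t : ℕ => (maxShift p₀ t : ℝ) / (√(t : ℝ) / Real.log t)) atTop
      (nhds (1 / (1 - p₀))) := by
  have h2 : Tendsto (fun t : ℕ => (⌈(t : ℝ) ^ ((1 : ℝ) / 3)⌉₊ : ℝ) / (√(t : ℝ) / Real.log t))
      atTop (nhds 0) := by
    have hub : Tendsto (fun t : ℕ => 2 * (Real.log t / (t : ℝ) ^ ((1 : ℝ) / 6))) atTop
        (nhds 0) := by
      simpa using (tendsto_log_div_rpow (r := 1 / 6) (by norm_num)).const_mul 2
    refine squeeze_zero' ?_ ?_ hub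
    · filter_upwards [eventually_pos_nat] with t ht
      have := ht.2.1
      positivity
    · filter_upwards [eventually_pos_nat, eventually_ge_atTop 1] with t ht ht1
      obtain ⟨hs, hlog, ht0⟩ := ht
      have ht1' : (1 : ℝ) ≤ t := by exact_mod_cast ht1
      have hc : (⌈(t : ℝ) ^ ((1 : ℝ) / 3)⌉₊ : ℝ) ≤ 2 * (t : ℝ) ^ ((1 : ℝ) / 3) := by
        have h3 := Nat.ceil_lt_add_one (a := (t : ℝ) ^ ((1 : ℝ) / 3)) (by positivity)
        have h4 : (1 : ℝ) ≤ (t : ℝ) ^ ((1 : ℝ) / 3) := Real.one_le_rpow ht1' (by norm_num)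
        linarith
      have hsq : √(t : ℝ) = (t : ℝ) ^ ((1 : ℝ) / 3) * (t : ℝ) ^ ((1 : ℝ) / 6) := by
        rw [Real.sqrt_eq_rpow, ← Real.rpow_add ht0]; norm_num
      rw [div_le_iff₀ (by positivity), hsq]
      have : 2 * (Real.log t / (t : ℝ) ^ ((1 : ℝ) / 6)) *
          ((t : ℝ) ^ ((1 : ℝ) / 3) * (t : ℝ) ^ ((1 : ℝ) / 6) / Real.log t) =
          2 * (t : ℝ) ^ ((1 : ℝ) / 3) := by
        field_simp
      linarith
  have h := (tendsto_gap hp₀').add h2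
  rw [add_zero] at h
  refine h.congr fun t => ?_
  rw [maxShift]
  push_cast
  ring

theorem tendsto_numLines (hp₀' : p₀ < 1) (hB : 0 < B) :
    Tendsto (fun t : ℕ => (numLines p₀ B t : ℝ) / Real.log t) atTop (nhds (2 * B)) := by
  have hq : 0 < 1 - p₀ := sub_pos.mpr hp₀'
  have hlow : Tendsto (fun t : ℕ => 2 * (boxH p₀ B t : ℝ) / (gap p₀ t : ℝ) / Real.log t) atTop
      (nhds (2 * B)) := by
    have hH : Tendsto (fun t : ℕ => (boxH p₀ B t : ℝ) / √(t : ℝ)) atTop (nhds (B / (1 - p₀))) :=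
      tendsto_boxW hp₀' hB
    have h := (hH.const_mul 2).div (tendsto_gap hp₀') (by positivity)
    rw [show 2 * (B / (1 - p₀)) / (1 / (1 - p₀)) = 2 * B by field_simp] at h
    refine h.congr' ?_
    filter_upwards [eventually_pos_nat] with t ht
    obtain ⟨hs, hlog, -⟩ := ht
    simp only [Pi.div_apply]
    by_cases hg : (gap p₀ t : ℝ) = 0
    · simp [hg]
    · field_simp
  have hup : Tendsto (fun t : ℕ => 2 * (boxH p₀ B t : ℝ) / (gap p₀ t : ℝ) / Real.log t +
      1 / Real.log t) atTop (nhds (2 * B)) := by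
    simpa using hlow.add (tendsto_log_nat.const_div_atTop 1)
  refine tendsto_of_tendsto_of_tendsto_of_le_of_le' hlow hup ?_ ?_
  · filter_upwards [eventually_pos_nat] with t ht
    have := ht.2.1
    gcongr
    exact Nat.le_ceil _
  · filter_upwards [eventually_pos_nat] with t ht
    have := ht.2.1
    rw [← add_div]
    gcongr
    exact (Nat.ceil_lt_add_one (by positivity)).le

theorem tendsto_vertical (hp₀' : p₀ < 1) (hB : 0 < B) :
    Tendsto (fun t : ℕ => (2 * (boxH p₀ B t + maxShift p₀ t + numLines p₀ B t * gap p₀ t) : ℝ) /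
      (√(t : ℝ) * Real.log t)) atTop (nhds 0) := by
  have hH : Tendsto (fun t : ℕ => (boxH p₀ B t : ℝ) / √(t : ℝ)) atTop (nhds (B / (1 - p₀))) :=
      tendsto_boxW hp₀' hB
  have hinv : Tendsto (fun t : ℕ => 1 / Real.log t) atTop (nhds 0) :=
    tendsto_log_nat.const_div_atTop 1
  have h := (((hH.mul hinv).add ((tendsto_maxShift hp₀').mul (hinv.mul hinv))).add
    (((tendsto_numLines hp₀' hB).mul (tendsto_gap hp₀')).mul hinv)).const_mul 2
  simp only [mul_zero, add_zero] at h
  refine h.congr' ?_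
  filter_upwards [eventually_pos_nat] with t ht
  obtain ⟨hs, hlog, -⟩ := ht
  field_simp

/-- Only the lines themselves, `2 * W * N` steps, are of order `√t ln t`; all the other moves
together are of smaller order. -/
theorem tendsto_phaseLength (hp₀' : p₀ < 1) (hA : 0 < A) (hB : 0 < B) :
    Tendsto (fun t : ℕ => (phaseLength p₀ A B t : ℝ) / (√(t : ℝ) * Real.log t)) atTop
      (nhds (4 * A * B / (1 - p₀))) := by
  have hlow : Tendsto (fun t : ℕ => (2 * boxW p₀ A t * numLines p₀ B t : ℝ) /
      (√(t : ℝ) * Real.log t)) atTop (nhds (4 * A * B / (1 - p₀))) := by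
    have h := ((tendsto_boxW hp₀' hA).const_mul 2).mul (tendsto_numLines hp₀' hB)
    rw [show 2 * (A / (1 - p₀)) * (2 * B) = 4 * A * B / (1 - p₀) by ring] at h
    refine h.congr fun t => ?_
    ring
  have hinv : Tendsto (fun t : ℕ => 1 / Real.log t) atTop (nhds 0) :=
    tendsto_log_nat.const_div_atTop 1
  have hup := (hlow.add (((tendsto_boxW hp₀' hA).mul hinv).const_mul 2)).add
    (tendsto_vertical hp₀' hB)
  simp only [mul_zero, add_zero] at hup
  refine tendsto_of_tendsto_of_tendsto_of_le_of_le' hlow hup ?_ ?_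
  · filter_upwards [eventually_pos_nat] with t ht
    have h1 := ht.1
    have h2 := ht.2.1
    gcongr
    exact_mod_cast le_phaseLength p₀ A B t
  · filter_upwards [eventually_pos_nat] with t ht
    obtain ⟨hs, hlog, -⟩ := ht
    rw [div_mul_div_comm, mul_one, mul_div_assoc', ← add_div, ← add_div]
    gcongr
    have h : ((phaseLength p₀ A B t : ℕ) : ℝ) ≤ _ := Nat.cast_le.mpr (phaseLength_le p₀ A B t)
    push_cast at h
    linarith

/-- The product of the duration of a phase and the range of its shift. -/
theorem tendsto_phaseLength_mul_maxShift (hp₀' : p₀ < 1) (hA : 0 < A) (hB : 0 < B) :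
    Tendsto (fun t : ℕ => (phaseLength p₀ A B t : ℝ) * maxShift p₀ t / t) atTop
      (nhds (4 * A * B / (1 - p₀) ^ 2)) := by
  have h := (tendsto_phaseLength hp₀' hA hB).mul (tendsto_maxShift hp₀')
  rw [show 4 * A * B / (1 - p₀) * (1 / (1 - p₀)) = 4 * A * B / (1 - p₀) ^ 2 by
    rw [div_mul_div_comm, mul_one, sq]] at h
  refine h.congr' ?_
  filter_upwards [eventually_pos_nat] with t ht
  obtain ⟨hs, hlog, ht0⟩ := ht
  rw [div_mul_div_comm]
  congr 1
  have := Real.mul_self_sqrt ht0.le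
  field_simp
  rw [sq]; exact this

/-- A phase is short compared with its starting time. Hence consecutive starting times are
asymptotically equal. -/
theorem tendsto_phaseLength_div (hp₀' : p₀ < 1) (hA : 0 < A) (hB : 0 < B) :
    Tendsto (fun t : ℕ => (phaseLength p₀ A B t : ℝ) / t) atTop (nhds 0) := by
  have h := (tendsto_phaseLength hp₀' hA hB).mul tendsto_log_div_sqrt
  rw [mul_zero] at h
  refine h.congr' ?_
  filter_upwards [eventually_pos_nat] with t ht
  obtain ⟨hs, hlog, ht0⟩ := ht
  have := Real.mul_self_sqrt ht0.le
  rw [div_mul_div_comm]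
  rw [div_eq_div_iff (by positivity) (by positivity)]
  rw [show √(t : ℝ) * Real.log t * √(t : ℝ) = (√(t : ℝ) * √(t : ℝ)) * Real.log t by ring, this]
  ring

/-- The proportion of vertical moves in a phase tends to zero. -/
theorem eventually_vertical_le (hp₀' : p₀ < 1) (hA : 0 < A) (hB : 0 < B) {ε : ℝ} (hε : 0 < ε) :
    ∀ᶠ t : ℕ in atTop, (2 * (boxH p₀ B t + maxShift p₀ t + numLines p₀ B t * gap p₀ t) : ℝ) ≤
      ε * phaseLength p₀ A B t := by
  have hq : 0 < 1 - p₀ := sub_pos.mpr hp₀'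
  have h := ((tendsto_phaseLength hp₀' hA hB).const_mul ε).sub (tendsto_vertical hp₀' hB)
  have hpos : 0 < ε * (4 * A * B / (1 - p₀)) - 0 := by rw [sub_zero]; positivity
  filter_upwards [h.eventually_const_lt hpos, eventually_pos_nat] with t ht ht'
  obtain ⟨hs, hlog, -⟩ := ht'
  rw [mul_div_assoc', ← sub_div] at ht
  have := (div_pos_iff_of_pos_right (by positivity)).mp ht
  linarith

end Phase

/-- Half of the extent of the swept box in a given direction, in units of `√t / (1 - p₀)`. -/
noncomputable def boxExtent (A B : ℝ) (e : Dir) : ℝ := if e.Vertical then B else A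

theorem tendsto_exp_log_sub_rpow (C : ℝ) {c r : ℝ} (hc : 0 < c) (hr : 0 < r) :
    Tendsto (fun t : ℕ => Real.exp (C * Real.log t - c * (t : ℝ) ^ r)) atTop (nhds 0) := by
  refine Real.tendsto_exp_atBot.comp ?_
  have h1 := ((tendsto_log_div_rpow hr).const_mul C).sub_const c
  rw [mul_zero, zero_sub] at h1
  have h2 : Tendsto (fun t : ℕ => (t : ℝ) ^ r) atTop atTop :=
    (tendsto_rpow_atTop hr).comp tendsto_natCast_atTop_atTop
  refine (h2.atTop_mul_neg (neg_lt_zero.mpr hc) h1).congr' ?_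
  filter_upwards [h2.eventually_gt_atTop 0] with t ht
  field_simp

/-! ### The hitting probability of a late phase -/

section

variable {p₀ A B : ℝ}

/-- If the home is inside the box, then the hitting probabilities for the different shifts add up
to almost `1`. -/
theorem eventually_le_sum_hits {p ε η : ℝ} (hp₀' : p₀ < 1) (hA : 0 < A) (hB : 0 < B)
    (hp : 0 ≤ p) (hp1 : p < 1) (hε : 0 < ε) (hη : 0 < η) (home : ℤ × ℤ) :
    ∀ᶠ t : ℕ in atTop, ∀ x : ℤ × ℤ,
      (∀ e : Dir, (e.comp x : ℝ) ≤
        (1 - ε) * ((1 - p) / (1 - p₀) * boxExtent A B e) * √(t : ℝ)) →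
      1 - η ≤ ∑ z ∈ Finset.Icc 1 (maxShift p₀ t),
        wordMean p (phaseLength p₀ A B t) (fun ω => ind (Hits x home (phase p₀ A B t z) ω)) := by
  have hq₀ : 0 < 1 - p₀ := sub_pos.mpr hp₀'
  have hq : 0 < 1 - p := sub_pos.mpr hp1
  set C := 4 * A * B / (1 - p₀) + 1 with hC
  -- the error terms
  have hL1 := (tendsto_phaseLength hp₀' hA hB).eventually_le_const
    (show 4 * A * B / (1 - p₀) < C by rw [hC]; linarith)
  have hL2 := (tendsto_phaseLength_div hp₀' hA hB).eventually_le_const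
    (show (0 : ℝ) < 1 / 2 by norm_num)
  -- With `s = t ^ (-1/4)` and `δ` of order `t ^ (1/3)`, the gain `s * δ` is of order `t ^ (1/12)`,
  -- while `5 * s ^ 2 * L ≤ 5 * C * ln t`. The prefactor `L + 1 ≤ t` adds one more `ln t`.
  have hsmall := (tendsto_exp_log_sub_rpow (5 * C + 1) (c := (1 - p) / 7) (r := 1 / 12)
    (by positivity) (by norm_num)).eventually_le_const (show 0 < η / 4 by positivity)
  have hmargin : ∀ c > 0, ∀ᶠ t : ℕ in atTop,
      (|(home.1 : ℝ)| + |(home.2 : ℝ)|) + 3 * ((1 - p) * (t : ℝ) ^ ((1 : ℝ) / 3) / 7) <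
        c * √(t : ℝ) := by
    intro c hc
    have h1 : Tendsto (fun t : ℕ => (t : ℝ) ^ (-((1 : ℝ) / 6))) atTop (nhds 0) :=
      (tendsto_rpow_neg_atTop (by norm_num)).comp tendsto_natCast_atTop_atTop
    have h2 := (tendsto_sqrt_nat.const_div_atTop (|(home.1 : ℝ)| + |(home.2 : ℝ)|)).add
      (h1.const_mul (3 * ((1 - p) / 7)))
    rw [mul_zero, add_zero] at h2
    filter_upwards [h2.eventually_lt_const hc, eventually_pos_nat] with t ht ht'
    obtain ⟨hs, -, ht0⟩ := ht'
    have h3 := mul_lt_mul_of_pos_right ht hs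
    refine lt_of_eq_of_lt ?_ h3
    have h4 : (t : ℝ) ^ (-((1 : ℝ) / 6)) * √(t : ℝ) = (t : ℝ) ^ ((1 : ℝ) / 3) := by
      rw [Real.sqrt_eq_rpow, ← Real.rpow_add ht0]; norm_num
    rw [add_mul, div_mul_cancel₀ _ hs.ne', mul_assoc (3 * ((1 - p) / 7)), h4]
    ring
  have hs1 : ∀ᶠ t : ℕ in atTop, (t : ℝ) ^ (-((1 : ℝ) / 4)) ≤ 1 / 2 :=
    ((tendsto_rpow_neg_atTop (by norm_num : (0 : ℝ) < 1 / 4)).comp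
      tendsto_natCast_atTop_atTop).eventually_le_const (by norm_num)
  filter_upwards [hL1, hL2, hsmall, hs1, eventually_pos_nat, eventually_ge_atTop 2,
    hmargin (ε * ((1 - p) / (1 - p₀) * A)) (by positivity),
    hmargin (ε * ((1 - p) / (1 - p₀) * B)) (by positivity)] with
    t hL1 hL2 hsmall hs1 hpos ht2 hmA hmB x hx
  obtain ⟨hs, hlog, ht0⟩ := hpos
  have ht2' : (2 : ℝ) ≤ t := by exact_mod_cast ht2
  -- The divisor `7` makes `6 * δ` smaller than `1 - p` times the excess of the shift range over the
  -- gap.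
  set δ := (1 - p) * (t : ℝ) ^ ((1 : ℝ) / 3) / 7 with hδ
  have hδ0 : 0 ≤ δ := by positivity
  have hw : (1 - p) / (1 - p₀) * A * √(t : ℝ) ≤ (1 - p) * boxW p₀ A t := by
    have := Nat.le_ceil (1 / (1 - p₀) * A * √(t : ℝ))
    calc _ = (1 - p) * (1 / (1 - p₀) * A * √(t : ℝ)) := by ring
      _ ≤ _ := mul_le_mul_of_nonneg_left this hq.le
  have hh : (1 - p) / (1 - p₀) * B * √(t : ℝ) ≤ (1 - p) * boxH p₀ B t := by
    have := Nat.le_ceil (1 / (1 - p₀) * B * √(t : ℝ))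
    calc _ = (1 - p) * (1 / (1 - p₀) * B * √(t : ℝ)) := by ring
      _ ≤ _ := mul_le_mul_of_nonneg_left this hq.le
  have hg : 0 < gap p₀ t := Nat.ceil_pos.mpr (by positivity)
  have hgR : (0 : ℝ) < gap p₀ t := by exact_mod_cast hg
  have hN : 2 * boxH p₀ B t ≤ numLines p₀ B t * gap p₀ t := by
    have h1 : _ ≤ (numLines p₀ B t : ℝ) := Nat.le_ceil (2 * (boxH p₀ B t : ℝ) / (gap p₀ t : ℝ))
    rw [div_le_iff₀ hgR] at h1
    exact_mod_cast h1
  have hM : 6 * δ < (1 - p) * ((maxShift p₀ t : ℝ) - gap p₀ t) := by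
    have h1 := Nat.le_ceil ((t : ℝ) ^ ((1 : ℝ) / 3))
    have h2 : (maxShift p₀ t : ℝ) - gap p₀ t = ⌈(t : ℝ) ^ ((1 : ℝ) / 3)⌉₊ := by
      rw [maxShift]; push_cast; ring
    have h3 : 0 < (t : ℝ) ^ ((1 : ℝ) / 3) := by positivity
    rw [h2]
    calc 6 * δ < (1 - p) * (t : ℝ) ^ ((1 : ℝ) / 3) := by
          have : 0 < (1 - p) * (t : ℝ) ^ ((1 : ℝ) / 3) := by positivity
          rw [hδ]; linarith
      _ ≤ _ := mul_le_mul_of_nonneg_left h1 hq.le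
  have hxE := hx .east
  have hxW := hx .west
  have hxN := hx .north
  have hxS := hx .south
  simp [Dir.comp, Dir.vec, boxExtent, Dir.Vertical] at hxE hxW hxN hxS
  have ha1 := neg_abs_le (home.1 : ℝ)
  have ha2 := le_abs_self (home.1 : ℝ)
  have ha3 := neg_abs_le (home.2 : ℝ)
  have ha4 := le_abs_self (home.2 : ℝ)
  have ha5 := abs_nonneg (home.1 : ℝ)
  have ha6 := abs_nonneg (home.2 : ℝ)
  have hmain := one_sub_le_sum_wordMean_hits (s := (t : ℝ) ^ (-((1 : ℝ) / 4))) (δ := δ) hp hp1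
    (by positivity) hs1 (x := x) (home := home) (w := boxW p₀ A t) (h := boxH p₀ B t)
    (g := gap p₀ t) (n := numLines p₀ B t) (M := maxShift p₀ t) (L := phaseLength p₀ A B t)
    (fun z => straight (-displacement (sweep p₀ A B t z))) hg hδ0
    (fun z hz => by rw [← phase_eq_sweepMoves, length_phase p₀ A B t z hz])
    (by simp only [Prod.fst_sub]; push_cast; linarith)
    (by simp only [Prod.fst_sub]; push_cast; linarith)
    (by simp only [Prod.snd_sub]; push_cast; linarith)
    (by simp only [Prod.snd_sub]; push_cast; linarith) hN hM
  simp only [← phase_eq_sweepMoves] at hmain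
  refine le_trans ?_ hmain
  -- the probability of a large deviation
  have hs2 : ((t : ℝ) ^ (-((1 : ℝ) / 4))) ^ 2 = 1 / √(t : ℝ) := by
    rw [← Real.rpow_natCast, ← Real.rpow_mul ht0.le, Real.sqrt_eq_rpow, one_div (_ ^ _),
      ← Real.rpow_neg ht0.le]
    norm_num
  have hsδ : (t : ℝ) ^ (-((1 : ℝ) / 4)) * δ = (1 - p) / 7 * (t : ℝ) ^ ((1 : ℝ) / 12) := by
    have : (t : ℝ) ^ (-((1 : ℝ) / 4)) * (t : ℝ) ^ ((1 : ℝ) / 3) = (t : ℝ) ^ ((1 : ℝ) / 12) := by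
      rw [← Real.rpow_add ht0]; norm_num
    rw [hδ, ← this]; ring
  have hsL : ((t : ℝ) ^ (-((1 : ℝ) / 4))) ^ 2 * phaseLength p₀ A B t ≤ C * Real.log t := by
    rw [div_le_iff₀ (by positivity)] at hL1
    rw [hs2, one_div_mul_eq_div, div_le_iff₀ hs]
    linarith
  have hLt : (phaseLength p₀ A B t : ℝ) + 1 ≤ t := by
    rw [div_le_iff₀ ht0] at hL2
    linarith
  have hbound : ((phaseLength p₀ A B t : ℝ) + 1) * Real.exp (-(t : ℝ) ^ (-((1 : ℝ) / 4)) * δ +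
      5 * ((t : ℝ) ^ (-((1 : ℝ) / 4))) ^ 2 * phaseLength p₀ A B t) ≤ η / 4 := by
    refine le_trans ?_ hsmall
    calc _ ≤ (t : ℝ) * Real.exp (-((1 - p) / 7 * (t : ℝ) ^ ((1 : ℝ) / 12)) +
          5 * (C * Real.log t)) := by
          refine mul_le_mul hLt (Real.exp_le_exp.mpr ?_) (Real.exp_pos _).le ht0.le
          linarith
      _ = _ := by
          nth_rewrite 1 [← Real.exp_log ht0]
          rw [← Real.exp_add]
          ring_nf
  linarith

end

/-! ### The recursion -/

/-- A bound for two coupled recursions: `f i` is the probability that the home has not been found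
at time `τ i`, and `F e i` is an exponential moment of the position on that event. -/
theorem exists_le_rpow_neg {α b ε γ K : ℝ} {τ f h ρ : ℕ → ℝ} {F : Dir → ℕ → ℝ} {i₀ : ℕ}
    (hα : 0 < α) (hb : 0 ≤ b) (hγ : 0 ≤ γ) (hK : K = Real.exp (2 * b + 2 * α + ε))
    (hτ : ∀ i ≥ i₀, 0 < τ i) (hρ : ∀ i ≥ i₀, ρ i = √(τ i / τ (i + 1)))
    (hρ0 : ∀ i ≥ i₀, 0 < ρ i) (hρ1 : ∀ i ≥ i₀, ρ i ≤ 1)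
    (hρε : ∀ i ≥ i₀, 2 * α ≤ (2 * α + ε) * ρ i)
    (hh0 : ∀ i ≥ i₀, 0 ≤ h i) (hh1 : ∀ i ≥ i₀, h i ≤ 1)
    (hF : ∀ i ≥ i₀, ∀ e, F e (i + 1) ≤
      (ρ i * K ^ (ρ i - 1) * F e i + (1 - ρ i) * K ^ ρ i * f i) * Real.exp (b * (1 - ρ i ^ 2)))
    (hf : ∀ i ≥ i₀, f (i + 1) ≤ (1 - h i) * f i + h i * (γ * ∑ e, F e i))
    (hτh : ∀ i ≥ i₀, α * ((τ (i + 1) - τ i) / τ i) ≤ h i * (1 - 4 * γ * K)) :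
    ∃ C, ∀ i ≥ i₀, f i ≤ C * τ i ^ (-α) := by
  have hKpos : 0 < K := hK ▸ Real.exp_pos _
  obtain ⟨C, hC, hf0, hF0⟩ : ∃ C, 0 ≤ C ∧ f i₀ ≤ C * τ i₀ ^ (-α) ∧
      ∀ e, F e i₀ ≤ K * (C * τ i₀ ^ (-α)) := by
    have hpos : 0 < τ i₀ ^ (-α) := Real.rpow_pos_of_pos (hτ i₀ le_rfl) _
    set D := |f i₀| + ∑ e, |F e i₀| / K with hD
    have hsum : 0 ≤ ∑ e, |F e i₀| / K := Finset.sum_nonneg fun e _ => by positivity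
    refine ⟨D / τ i₀ ^ (-α), by positivity, ?_, fun e => ?_⟩
    · rw [div_mul_cancel₀ _ hpos.ne']
      have := le_abs_self (f i₀)
      linarith
    · rw [div_mul_cancel₀ _ hpos.ne', ← div_le_iff₀' hKpos]
      have h1 := Finset.single_le_sum (f := fun e => |F e i₀| / K) (fun e _ => by positivity)
        (Finset.mem_univ e)
      have h2 : F e i₀ / K ≤ |F e i₀| / K := by gcongr; exact le_abs_self _
      have h3 := abs_nonneg (f i₀)
      have h4 : |F e i₀| / K ≤ ∑ e, |F e i₀| / K := h1
      linarith
  refine ⟨C, fun i hi => ?_⟩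
  -- The two bounds have to be carried together: the moments control the failure of the box in `f`,
  -- and `f` enters the interpolation in `F`.
  suffices f i ≤ C * τ i ^ (-α) ∧ ∀ e, F e i ≤ K * (C * τ i ^ (-α)) from this.1
  induction i, hi using Nat.le_induction with
  | base => exact ⟨hf0, hF0⟩
  | succ i hi ih =>
    obtain ⟨ihf, ihF⟩ := ih
    set y := C * τ i ^ (-α) with hy
    have hτi := hτ i hi
    have hτi' := hτ (i + 1) (by omega)
    have hy0 : 0 ≤ y := by positivity
    have hr0 := hρ0 i hi
    have hr1 := hρ1 i hi
    have hrε := hρε i hi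
    have hyρ : C * τ (i + 1) ^ (-α) = y * ρ i ^ (2 * α) := by
      have h1 : ρ i ^ (2 * α) = (τ i / τ (i + 1)) ^ α := by
        rw [hρ i hi, Real.sqrt_eq_rpow, ← Real.rpow_mul (by positivity)]
        congr 1; ring
      rw [h1, hy, Real.div_rpow hτi.le hτi'.le, Real.rpow_neg hτi.le, Real.rpow_neg hτi'.le]
      have := Real.rpow_pos_of_pos hτi α
      field_simp
    rw [hyρ]
    refine ⟨?_, fun e => ?_⟩
    · have hsum : ∑ e, F e i ≤ 4 * (K * y) := by
        rw [sum_dir]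
        linarith [ihF .east, ihF .west, ihF .north, ihF .south]
      calc f (i + 1) ≤ (1 - h i) * f i + h i * (γ * ∑ e, F e i) := hf i hi
        _ ≤ (1 - h i) * y + h i * (γ * (4 * (K * y))) := by
            have := hh0 i hi
            have := sub_nonneg.mpr (hh1 i hi)
            gcongr
        _ = y * (1 - h i * (1 - 4 * γ * K)) := by ring
        _ ≤ y * Real.exp (-(α * ((τ (i + 1) - τ i) / τ i))) := by
            gcongr
            have := Real.add_one_le_exp (-(α * ((τ (i + 1) - τ i) / τ i)))
            linarith [hτh i hi]
        _ ≤ y * ρ i ^ (2 * α) := by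
            gcongr
            -- It remains to compare `exp (-α * (u - 1))` with `u ^ (-α)` for `u = τ (i + 1) / τ i`,
            -- which is `ln u ≤ u - 1`.
            have h1 : ρ i ^ (2 * α) = (τ (i + 1) / τ i) ^ (-α) := by
              rw [hρ i hi, Real.sqrt_eq_rpow, ← Real.rpow_mul (by positivity),
                Real.rpow_neg (by positivity), ← Real.inv_rpow (by positivity), inv_div]
              congr 1; ring
            rw [h1, Real.rpow_def_of_pos (by positivity)]
            refine Real.exp_le_exp.mpr ?_
            have h2 := Real.log_le_sub_one_of_pos (show 0 < τ (i + 1) / τ i by positivity)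
            have h3 : (τ (i + 1) - τ i) / τ i = τ (i + 1) / τ i - 1 := by field_simp
            rw [h3]
            nlinarith
    · have hKr : K ^ (ρ i - 1) * K = K ^ ρ i := by
        rw [← Real.rpow_add_one hKpos.ne']; congr 1; ring
      calc F e (i + 1) ≤ (ρ i * K ^ (ρ i - 1) * F e i + (1 - ρ i) * K ^ ρ i * f i) *
            Real.exp (b * (1 - ρ i ^ 2)) := hF i hi e
        _ ≤ (ρ i * K ^ (ρ i - 1) * (K * y) + (1 - ρ i) * K ^ ρ i * y) *
            Real.exp (b * (1 - ρ i ^ 2)) := by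
            have := sub_nonneg.mpr hr1
            have := ihF e
            gcongr
        _ = K ^ ρ i * Real.exp (b * (1 - ρ i ^ 2)) * y := by rw [← hKr]; ring
        _ ≤ K * ρ i ^ (2 * α) * y := by
            refine mul_le_mul_of_nonneg_right ?_ hy0
            -- In logarithms the claim is `b * (1 - ρ²) + 2 * α * ln (1 / ρ) ≤ (1 - ρ) * ln K`. As
            -- `1 - ρ² ≤ 2 * (1 - ρ)` and `ln (1 / ρ) ≤ (1 - ρ) / ρ`, with `ρ` close to `1`, the
            -- choice `ln K = 2 * b + 2 * α + ε` suffices.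
            rw [hK, ← Real.exp_mul, Real.rpow_def_of_pos hr0, ← Real.exp_add, ← Real.exp_add]
            refine Real.exp_le_exp.mpr ?_
            have h1 := Real.one_sub_inv_le_log_of_pos hr0
            have h2 : 2 * α * (ρ i)⁻¹ ≤ 2 * α + ε := by
              rw [← div_eq_mul_inv, div_le_iff₀ hr0]; exact hrε
            have h3 : 2 * α * (1 - (ρ i)⁻¹) = -((1 - ρ i) * (2 * α * (ρ i)⁻¹)) := by
              field_simp; ring
            have h4 : 2 * α * (1 - (ρ i)⁻¹) ≤ Real.log (ρ i) * (2 * α) := by nlinarith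
            have h5 : 0 ≤ 1 - ρ i := by linarith
            have h6 := mul_le_mul_of_nonneg_left h2 h5
            nlinarith [mul_nonneg hb (mul_nonneg h5 h5)]
        _ = _ := by ring

/-! ### Independence of the past -/

section Past

variable {Ω : Type*}

/-- The σ-algebra generated by one of the random variables. -/
abbrev sourceSigma (ξ : ℕ → Ω → Outcome) (Z : ℕ → Ω → ℕ) : ℕ ⊕ ℕ → MeasurableSpace Ω
  | .inl s => MeasurableSpace.comap (ξ s) inferInstance
  | .inr j => MeasurableSpace.comap (Z j) inferInstance

/-- The σ-algebra generated by the first `t` outcomes and the first `i` shifts. -/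
abbrev pastSigma (ξ : ℕ → Ω → Outcome) (Z : ℕ → Ω → ℕ) (t i : ℕ) : MeasurableSpace Ω :=
  ⨆ k ∈ {k : ℕ ⊕ ℕ | Sum.elim (· < t) (· < i) k}, sourceSigma ξ Z k

variable {ξ : ℕ → Ω → Outcome} {Z : ℕ → Ω → ℕ}

/-- An event that is determined by the first `t` outcomes and the first `i` shifts. -/
theorem measurableSet_pastSigma {t i : ℕ} {Q : (ℕ → Outcome) → (ℕ → ℕ) → Prop}
    (hQ : ∀ x x' z z', (∀ s < t, x s = x' s) → (∀ j < i, z j = z' j) → Q x z → Q x' z') :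
    MeasurableSet[pastSigma ξ Z t i] {ω | Q (fun s => ξ s ω) (fun j => Z j ω)} := by
  have h1 : ∀ s < t, @Measurable _ _ (pastSigma ξ Z t i) _ (ξ s) := by
    intro s hs
    have : sourceSigma ξ Z (.inl s) ≤ pastSigma ξ Z t i :=
      le_iSup₂_of_le (f := fun k (_ : k ∈ {k : ℕ ⊕ ℕ | Sum.elim (· < t) (· < i) k}) =>
        sourceSigma ξ Z k) (.inl s) hs le_rfl
    exact measurable_iff_comap_le.mpr this
  have h2 : ∀ j < i, @Measurable _ _ (pastSigma ξ Z t i) _ (Z j) := by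
    intro j hj
    have : sourceSigma ξ Z (.inr j) ≤ pastSigma ξ Z t i :=
      le_iSup₂_of_le (f := fun k (_ : k ∈ {k : ℕ ⊕ ℕ | Sum.elim (· < t) (· < i) k}) =>
        sourceSigma ξ Z k) (.inr j) hj le_rfl
    exact measurable_iff_comap_le.mpr this
  have hDO : DiscreteMeasurableSpace Outcome := ⟨fun _ => trivial⟩
  have hmeas : @Measurable _ _ (pastSigma ξ Z t i) _
      (fun ω => ((fun s : Fin t => ξ s ω), (fun j : Fin i => Z j ω))) := by
    refine Measurable.prodMk ?_ ?_
    · exact @measurable_pi_lambda _ _ _ (pastSigma ξ Z t i) _ _ fun s => h1 s s.2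
    · exact @measurable_pi_lambda _ _ _ (pastSigma ξ Z t i) _ _ fun j => h2 j j.2
  -- `Q` ignores the coordinates that are filled with default values. It is thus a condition on a
  -- countable discrete space, where every set is measurable.
  have hset : {ω | Q (fun s => ξ s ω) (fun j => Z j ω)} =
      (fun ω => ((fun s : Fin t => ξ s ω), (fun j : Fin i => Z j ω))) ⁻¹'
        {ab | Q (fun s => if hs : s < t then ab.1 ⟨s, hs⟩ else .follow)
          (fun j => if hj : j < i then ab.2 ⟨j, hj⟩ else 0)} := by
    ext ω
    constructor <;> refine hQ _ _ _ _ ?_ ?_ <;> intro s hs <;> simp [hs]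
  rw [hset]
  exact hmeas (MeasurableSet.of_discrete)

variable [mΩ : MeasurableSpace Ω] {μ : Measure Ω} {p p₀ A B : ℝ} {t₀ : ℕ}

theorem IsSweepingRandomness.sourceSigma_le (h : IsSweepingRandomness μ p p₀ A B t₀ ξ Z)
    (k : ℕ ⊕ ℕ) : sourceSigma ξ Z k ≤ mΩ := by
  rcases k with s | j
  · exact (h.measurable_outcome s).comap_le
  · exact (h.measurable_shift j).comap_le

theorem IsSweepingRandomness.pastSigma_le (h : IsSweepingRandomness μ p p₀ A B t₀ ξ Z)
    (t i : ℕ) : pastSigma ξ Z t i ≤ mΩ := iSup₂_le fun k _ => h.sourceSigma_le k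

/-- A finite intersection splits into an outcome part and a shift part. These are independent of
each other, and each factors within its own family. -/
theorem IsSweepingRandomness.iIndep_sourceSigma
    (h : IsSweepingRandomness μ p p₀ A B t₀ ξ Z) : iIndep (sourceSigma ξ Z) μ := by
  rw [iIndep_iff]
  intro s f hf
  have hsplit : (⋂ k ∈ s, f k) = (⋂ a ∈ s.toLeft, f (.inl a)) ∩ (⋂ b ∈ s.toRight, f (.inr b)) := by
    ext ω
    simp only [Set.mem_iInter, Set.mem_inter_iff, Finset.mem_toLeft, Finset.mem_toRight]
    constructor
    · intro hk
      exact ⟨fun a ha => hk _ ha, fun b hb => hk _ hb⟩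
    · rintro ⟨h1, h2⟩ (a | b) hk
      · exact h1 a hk
      · exact h2 b hk
  have hl : ∀ a ∈ s.toLeft, MeasurableSet[MeasurableSpace.comap (ξ a) inferInstance]
      (f (.inl a)) := fun a ha => hf _ (Finset.mem_toLeft.mp ha)
  have hr : ∀ b ∈ s.toRight, MeasurableSet[MeasurableSpace.comap (Z b) inferInstance]
      (f (.inr b)) := fun b hb => hf _ (Finset.mem_toRight.mp hb)
  have hL : MeasurableSet[MeasurableSpace.comap (fun ω t => ξ t ω) inferInstance]
      (⋂ a ∈ s.toLeft, f (.inl a)) := by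
    refine Finset.measurableSet_biInter _ fun a ha => ?_
    obtain ⟨S, hS, hSf⟩ := hl a ha
    exact ⟨_, measurable_pi_apply a hS, hSf⟩
  have hR : MeasurableSet[MeasurableSpace.comap (fun ω i => Z i ω) inferInstance]
      (⋂ b ∈ s.toRight, f (.inr b)) := by
    refine Finset.measurableSet_biInter _ fun b hb => ?_
    obtain ⟨S, hS, hSf⟩ := hr b hb
    exact ⟨_, measurable_pi_apply b hS, hSf⟩
  rw [hsplit, h.indep_outcome_shift.meas_inter hL hR, h.indep_outcome.meas_biInter hl,
    h.indep_shift.meas_biInter hr]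
  conv_rhs => rw [← Finset.toLeft_disjSum_toRight (u := s), Finset.prod_disjSum]

theorem IsSweepingRandomness.indep_past (h : IsSweepingRandomness μ p p₀ A B t₀ ξ Z)
    {t i : ℕ} {k : ℕ ⊕ ℕ} (hk : ¬ Sum.elim (· < t) (· < i) k) {E E' : Set Ω}
    (hE : MeasurableSet[pastSigma ξ Z t i] E) (hE' : MeasurableSet[sourceSigma ξ Z k] E') :
    μ.real (E ∩ E') = μ.real E * μ.real E' := by
  have hdisj : Disjoint {k : ℕ ⊕ ℕ | Sum.elim (· < t) (· < i) k} {k} :=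
    Set.disjoint_singleton_right.mpr hk
  have hi := indep_iSup_of_disjoint h.sourceSigma_le h.iIndep_sourceSigma hdisj
  rw [Indep_iff] at hi
  have h2 := hi E E' hE (by rw [iSup_singleton]; exact hE')
  simp only [measureReal_def, h2, ENNReal.toReal_mul]

theorem IsSweepingRandomness.measureReal_inter_outcome
    (h : IsSweepingRandomness μ p p₀ A B t₀ ξ Z) (hp : 0 ≤ p) (hp1 : p ≤ 1)
    {t i : ℕ} {E : Set Ω} (hE : MeasurableSet[pastSigma ξ Z t i] E) (o : Outcome) :
    μ.real (E ∩ {ω | ξ t ω = o}) = μ.real E * outcomeProb p o := by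
  rw [h.indep_past (k := .inl t) (E' := {ω | ξ t ω = o}) (by simp) hE ⟨{o}, trivial, rfl⟩]
  congr 1
  rcases o with _ | d
  · rw [measureReal_def, h.prob_follow, ENNReal.toReal_ofReal (by linarith), outcomeProb]
  · rw [measureReal_def, h.prob_mistake, ENNReal.toReal_ofReal (by linarith), outcomeProb]

theorem IsSweepingRandomness.measureReal_inter_shift
    (h : IsSweepingRandomness μ p p₀ A B t₀ ξ Z)
    {t i : ℕ} {E : Set Ω} (hE : MeasurableSet[pastSigma ξ Z t i] E) {z : ℕ}
    (hz : z ∈ Finset.Icc 1 (maxShift p₀ (startTime p₀ A B t₀ i))) :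
    μ.real (E ∩ {ω | Z i ω = z}) = μ.real E / maxShift p₀ (startTime p₀ A B t₀ i) := by
  rw [h.indep_past (k := .inr i) (E' := {ω | Z i ω = z}) (by simp) hE
    ⟨{z}, MeasurableSet.of_discrete, rfl⟩, div_eq_mul_inv]
  congr 1
  rw [measureReal_def, h.prob_shift i z hz, ENNReal.toReal_inv, ENNReal.toReal_natCast]

/-- The prescribed masses on `{1, …, M}` already add up to `1`, which leaves no mass for other
values. -/
theorem IsSweepingRandomness.ae_shift_mem [IsProbabilityMeasure μ] (h : IsSweepingRandomness μ p p₀ A B t₀ ξ Z)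
    (hM : ∀ i, 0 < maxShift p₀ (startTime p₀ A B t₀ i)) :
    ∀ᵐ ω ∂μ, ∀ i, Z i ω ∈ Finset.Icc 1 (maxShift p₀ (startTime p₀ A B t₀ i)) := by
  rw [ae_all_iff]
  intro i
  set M := maxShift p₀ (startTime p₀ A B t₀ i) with hMdef
  have hmeas : ∀ z, MeasurableSet {ω | Z i ω = z} := fun z =>
    h.measurable_shift i (measurableSet_singleton z)
  have h1 : μ (⋃ z ∈ Finset.Icc 1 M, {ω | Z i ω = z}) = 1 := by
    rw [measure_biUnion_finset]
    · rw [Finset.sum_congr rfl fun z hz => h.prob_shift i z hz, Finset.sum_const, Nat.card_Icc,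
        nsmul_eq_mul, ← hMdef, Nat.add_sub_cancel]
      exact ENNReal.mul_inv_cancel (by exact_mod_cast (hM i).ne') (ENNReal.natCast_ne_top _)
    · intro a _ b _ hab
      exact Set.disjoint_left.mpr fun ω (h1 : Z i ω = a) (h2 : Z i ω = b) => hab (h1 ▸ h2)
    · exact fun z _ => hmeas z
  have h2 := (prob_compl_eq_zero_iff
    (Finset.measurableSet_biUnion _ fun z _ => hmeas z)).mpr h1
  rw [ae_iff]
  refine measure_mono_null ?_ h2
  intro ω hω
  simp only [Set.mem_compl_iff, Set.mem_iUnion, not_exists]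
  rintro z hz (hzω : Z i ω = z)
  exact hω (hzω ▸ hz)

/-- The outcomes of `n` steps from time `t` on. -/
def outcomeWord (x : ℕ → Outcome) (t n : ℕ) : List Outcome := (List.range' t n).map x

theorem outcomeWord_succ (x : ℕ → Outcome) (t n : ℕ) :
    outcomeWord x t (n + 1) = x t :: outcomeWord x (t + 1) n := rfl

theorem length_outcomeWord (x : ℕ → Outcome) (t n : ℕ) : (outcomeWord x t n).length = n := by
  simp [outcomeWord]

theorem outcomeWord_congr {x x' : ℕ → Outcome} {t n : ℕ} (h : ∀ s < t + n, x s = x' s) :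
    outcomeWord x t n = outcomeWord x' t n := by
  refine List.map_congr_left fun s hs => h s ?_
  simp only [List.mem_range'_1] at hs
  exact hs.2

theorem outcomeWord_add (x : ℕ → Outcome) (t m n : ℕ) :
    outcomeWord x t (m + n) = outcomeWord x t m ++ outcomeWord x (t + m) n := by
  rw [outcomeWord, outcomeWord, outcomeWord, ← List.map_append]
  congr 1
  rw [List.range'_append_1]

theorem take_outcomeWord (x : ℕ → Outcome) (t : ℕ) {k n : ℕ} (hk : k ≤ n) :
    (outcomeWord x t n).take k = outcomeWord x t k := by
  obtain ⟨m, rfl⟩ := Nat.exists_eq_add_of_le hk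
  rw [outcomeWord_add, List.take_append_of_le_length (length_outcomeWord ..).ge,
    List.take_of_length_le (length_outcomeWord ..).le]

/-- The law of the outcomes of `n` steps, given the past. -/
theorem IsSweepingRandomness.measureReal_inter_word
    [IsProbabilityMeasure μ] (h : IsSweepingRandomness μ p p₀ A B t₀ ξ Z) (hp : 0 ≤ p) (hp1 : p ≤ 1)
    {t i : ℕ} {E : Set Ω} (hE : MeasurableSet[pastSigma ξ Z t i] E) (n : ℕ)
    (S : List Outcome → Prop) :
    μ.real (E ∩ {ω | S (outcomeWord (fun s => ξ s ω) t n)}) =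
      μ.real E * wordMean p n (fun w => ind (S w)) := by
  induction n generalizing t E S with
  | zero =>
    by_cases hS : S []
    · have : {ω | S (outcomeWord (fun s => ξ s ω) t 0)} = Set.univ := by
        ext ω; simpa [outcomeWord] using hS
      rw [this, Set.inter_univ, wordMean, ind_of hS, mul_one]
    · have : {ω | S (outcomeWord (fun s => ξ s ω) t 0)} = ∅ := by
        ext ω; simpa [outcomeWord] using hS
      rw [this, Set.inter_empty, wordMean, ind_of_not hS, mul_zero, measureReal_empty]
  | succ n ih =>
    have hmono : pastSigma ξ Z t i ≤ pastSigma ξ Z (t + 1) i := by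
      refine biSup_mono fun k hk => ?_
      rcases k with s | j
      · exact Nat.lt_succ_of_lt hk
      · exact hk
    have hlast : ∀ o, MeasurableSet[pastSigma ξ Z (t + 1) i] {ω | ξ t ω = o} := by
      intro o
      refine measurableSet_pastSigma (Q := fun x _ => x t = o) ?_
      intro x x' z z' hx _ hxt
      rw [← hx t (Nat.lt_succ_self t)]; exact hxt
    -- Conditioning on the first outcome keeps the event in the past, one step later, so the
    -- induction hypothesis applies to it.
    have hpart : ∀ o, MeasurableSet[pastSigma ξ Z (t + 1) i] (E ∩ {ω | ξ t ω = o}) := fun o =>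
      MeasurableSet.inter (hmono _ hE) (hlast o)
    have hword : ∀ S' : List Outcome → Prop,
        MeasurableSet {ω | S' (outcomeWord (fun s => ξ s ω) (t + 1) n)} := by
      intro S'
      refine h.pastSigma_le (t + 1 + n) i _ (measurableSet_pastSigma
        (Q := fun x _ => S' (outcomeWord x (t + 1) n)) ?_)
      intro x x' z z' hx _ hS
      rwa [← outcomeWord_congr hx]
    have hsplit : E ∩ {ω | S (outcomeWord (fun s => ξ s ω) t (n + 1))} =
        ⋃ o ∈ (Finset.univ : Finset Outcome), (E ∩ {ω | ξ t ω = o}) ∩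
          {ω | S (o :: outcomeWord (fun s => ξ s ω) (t + 1) n)} := by
      ext ω
      simp only [outcomeWord_succ, Set.mem_inter_iff, Set.mem_ofPred_eq, Finset.mem_univ,
        Set.iUnion_true, Set.mem_iUnion]
      constructor
      · rintro ⟨h1, h2⟩
        exact ⟨_, ⟨h1, rfl⟩, h2⟩
      · rintro ⟨o, ⟨h1, rfl⟩, h2⟩
        exact ⟨h1, h2⟩
    rw [hsplit, measureReal_biUnion_finset]
    · simp only [wordMean, outcomeMean, Finset.mul_sum]
      refine Finset.sum_congr rfl fun o _ => ?_
      rw [ih (hpart o) (fun w => S (o :: w)), h.measureReal_inter_outcome hp hp1 hE o, mul_assoc]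
    · intro a _ b _ hab
      refine Set.disjoint_left.mpr ?_
      rintro ω ⟨⟨-, h1 : ξ t ω = a⟩, -⟩ ⟨⟨-, h2 : ξ t ω = b⟩, -⟩
      exact hab (h1 ▸ h2)
    · intro o _
      exact (h.pastSigma_le _ _ _ (hpart o)).inter (hword fun w => S (o :: w))

end Past

/-! ### The walk at the beginning of the phases -/

section Walk

variable {p₀ A B : ℝ} {l₀ : List Dir}

theorem startTime_pos (ht : 0 < l₀.length) (n : ℕ) : 0 < startTime p₀ A B l₀.length n := by
  induction n with
  | zero => exact ht
  | succ n ih => rw [startTime]; omega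

theorem boxW_pos (hp₀' : p₀ < 1) (hA : 0 < A) {t : ℕ} (ht : 0 < t) : 0 < boxW p₀ A t := by
  have hq : 0 < 1 - p₀ := sub_pos.mpr hp₀'
  have ht' : (0 : ℝ) < t := by exact_mod_cast ht
  exact Nat.ceil_pos.mpr (by positivity)

theorem maxShift_pos {t : ℕ} (ht : 0 < t) : 0 < maxShift p₀ t := by
  have ht' : (0 : ℝ) < t := by exact_mod_cast ht
  exact Nat.add_pos_right _ (Nat.ceil_pos.mpr (by positivity))

theorem length_phase_pos (hp₀' : p₀ < 1) (hA : 0 < A) {t : ℕ} (ht : 0 < t) (z : ℕ) :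
    0 < (phase p₀ A B t z).length := by
  have := boxW_pos hp₀' hA ht
  simp only [phase, sweep, List.length_append, List.length_replicate]
  omega

theorem startTime_lt_succ (hp₀' : p₀ < 1) (hA : 0 < A) (ht : 0 < l₀.length) (n : ℕ) :
    startTime p₀ A B l₀.length n < startTime p₀ A B l₀.length (n + 1) := by
  have := length_phase_pos (B := B) hp₀' hA (startTime_pos (p₀ := p₀) (A := A) (B := B) ht n) 0
  rw [startTime, phaseLength]
  omega

theorem le_length_moves (hp₀' : p₀ < 1) (hA : 0 < A) (ht : 0 < l₀.length) (z : ℕ → ℕ) (n : ℕ) :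
    n ≤ (moves p₀ A B l₀ z n).length := by
  induction n with
  | zero => exact Nat.zero_le _
  | succ n ih =>
    have := length_phase_pos (B := B) hp₀' hA
      (startTime_pos (p₀ := p₀) (A := A) (B := B) ht n) (z n)
    rw [moves, List.length_append]
    omega

theorem length_moves {z : ℕ → ℕ} {n : ℕ}
    (hz : ∀ j < n, z j ≤ maxShift p₀ (startTime p₀ A B l₀.length j)) :
    (moves p₀ A B l₀ z n).length = startTime p₀ A B l₀.length n := by
  induction n with
  | zero => rfl
  | succ n ih =>
    rw [moves, List.length_append, ih fun j hj => hz j (by omega), startTime,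
      length_phase _ _ _ _ _ (hz n (by omega))]

theorem moves_congr {z z' : ℕ → ℕ} {n : ℕ} (h : ∀ j < n, z j = z' j) :
    moves p₀ A B l₀ z n = moves p₀ A B l₀ z' n := by
  induction n with
  | zero => rfl
  | succ n ih => rw [moves, moves, ih fun j hj => h j (by omega), h n (by omega)]

theorem moves_prefix (z : ℕ → ℕ) {m n : ℕ} (h : m ≤ n) :
    moves p₀ A B l₀ z m <+: moves p₀ A B l₀ z n := by
  induction n, h using Nat.le_induction with
  | base => exact List.prefix_rfl
  | succ n _ ih => exact ih.trans (List.prefix_append _ _)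

/-- The instruction at time `s` is defined from the first `s` phases; any number of phases that
covers time `s` gives the same one. -/
theorem take_moves_eq (z : ℕ → ℕ) {m n s : ℕ} (hm : s ≤ (moves p₀ A B l₀ z m).length)
    (hn : s ≤ (moves p₀ A B l₀ z n).length) :
    (moves p₀ A B l₀ z m).take s = (moves p₀ A B l₀ z n).take s := by
  have key : ∀ {a b : ℕ}, a ≤ b → s ≤ (moves p₀ A B l₀ z a).length →
      (moves p₀ A B l₀ z a).take s = (moves p₀ A B l₀ z b).take s := by
    intro a b hab ha
    obtain ⟨r, hr⟩ := moves_prefix (p₀ := p₀) (A := A) (B := B) (l₀ := l₀) z hab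
    rw [← hr, List.take_append_of_le_length ha]
  rcases le_total m n with h | h
  · exact key h hm
  · exact (key h hn).symm

theorem sweepingInstructions_eq (hp₀' : p₀ < 1) (hA : 0 < A) (ht : 0 < l₀.length) (z : ℕ → ℕ)
    {n s : ℕ} (hs : s ≤ (moves p₀ A B l₀ z n).length) :
    sweepingInstructions p₀ A B l₀ z s = displacement ((moves p₀ A B l₀ z n).take s) := by
  rw [sweepingInstructions, take_moves_eq z (le_length_moves hp₀' hA ht z s) hs]

theorem guidedWalk_eq_agentDisp {x : ℕ → ℤ × ℤ} {l : List Dir}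
    (hx : ∀ s ≤ l.length, x s = displacement (l.take s)) (y : ℕ → Outcome) {s : ℕ}
    (hs : s ≤ l.length) : guidedWalk x y s = agentDisp (l.take s) (outcomeWord y 0 s) := by
  induction s with
  | zero => simp [guidedWalk, agentDisp]
  | succ s ih =>
    have hs' : s < l.length := hs
    have h1 : x (s + 1) - x s = l[s].vec := by
      rw [hx (s + 1) hs, hx s hs'.le, ← List.take_append_getElem hs', displacement_append]
      simp [displacement]
    rw [guidedWalk, ih hs'.le, outcomeWord_add, ← List.take_append_getElem hs',
      agentDisp_append (by simp [length_outcomeWord]; omega)]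
    congr 1
    simp only [outcomeWord, agentDisp, zero_add, List.range'_one, List.map_cons, List.map_nil,
      List.zipWith_cons_cons, List.zipWith_nil_left, List.sum_cons, List.sum_nil, add_zero]
    rw [h1]
    cases y s <;> rfl

variable (p₀ A B l₀) in
/-- The position at time `s` of the agent that is given the moves of the first `i` phases. -/
noncomputable def posAt (x : ℕ → Outcome) (z : ℕ → ℕ) (i s : ℕ) : ℤ × ℤ :=
  agentDisp ((moves p₀ A B l₀ z i).take s) (outcomeWord x 0 s)

theorem guidedWalk_sweepingInstructions (hp₀' : p₀ < 1) (hA : 0 < A) (ht : 0 < l₀.length)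
    (x : ℕ → Outcome) (z : ℕ → ℕ) {i s : ℕ} (hs : s ≤ (moves p₀ A B l₀ z i).length) :
    guidedWalk (sweepingInstructions p₀ A B l₀ z) x s = posAt p₀ A B l₀ x z i s :=
  guidedWalk_eq_agentDisp (fun _ h => sweepingInstructions_eq hp₀' hA ht z h) x hs

theorem posAt_succ_of_le (x : ℕ → Outcome) {z : ℕ → ℕ} {i s : ℕ}
    (hs : s ≤ (moves p₀ A B l₀ z i).length) :
    posAt p₀ A B l₀ x z (i + 1) s = posAt p₀ A B l₀ x z i s := by
  rw [posAt, posAt, moves, List.take_append_of_le_length hs]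

theorem posAt_succ_add (x : ℕ → Outcome) {z : ℕ → ℕ} {i k : ℕ}
    (hi : (moves p₀ A B l₀ z i).length = startTime p₀ A B l₀.length i) :
    posAt p₀ A B l₀ x z (i + 1) (startTime p₀ A B l₀.length i + k) =
      posAt p₀ A B l₀ x z i (startTime p₀ A B l₀.length i) +
      agentDisp ((phase p₀ A B (startTime p₀ A B l₀.length i) (z i)).take k)
        (outcomeWord x (startTime p₀ A B l₀.length i) k) := by
  rw [posAt, posAt, moves, outcomeWord_add, zero_add]
  nth_rewrite 1 [← hi]
  rw [List.take_length_add_append, agentDisp_append (by rw [length_outcomeWord, hi])]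
  rw [List.take_of_length_le hi.le]

theorem abs_agentDisp_le (l : List Dir) (w : List Outcome) :
    |(agentDisp l w).1| ≤ l.length ∧ |(agentDisp l w).2| ≤ l.length := by
  induction l generalizing w with
  | nil => simp [agentDisp]
  | cons d l ih =>
    rcases w with _ | ⟨o, w⟩
    · simp [agentDisp]; positivity
    · have hstep : |(step d o).1| ≤ 1 ∧ |(step d o).2| ≤ 1 := by
        rcases o with _ | d'
        · cases d <;> simp [step, Dir.vec]
        · cases d' <;> simp [step, Dir.vec]
      rw [agentDisp_cons, Prod.fst_add, Prod.snd_add, List.length_cons]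
      have h1 := abs_add_le (step d o).1 (agentDisp l w).1
      have h2 := abs_add_le (step d o).2 (agentDisp l w).2
      push_cast
      constructor <;> linarith [(ih w).1, (ih w).2]

/-- A finite set of lattice points that contains every position that can be reached in time `t`. -/
noncomputable def reachable (t : ℕ) : Finset (ℤ × ℤ) := Finset.Icc (-(t : ℤ)) t ×ˢ Finset.Icc (-(t : ℤ)) t

theorem posAt_mem_reachable (x : ℕ → Outcome) (z : ℕ → ℕ) (i s : ℕ) :
    posAt p₀ A B l₀ x z i s ∈ reachable s := by
  have h := abs_agentDisp_le ((moves p₀ A B l₀ z i).take s) (outcomeWord x 0 s)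
  have hlen : (((moves p₀ A B l₀ z i).take s).length : ℤ) ≤ s := by
    exact_mod_cast List.length_take_le _ _
  rw [reachable, Finset.mem_product, Finset.mem_Icc, Finset.mem_Icc]
  exact ⟨abs_le.mp (h.1.trans hlen), abs_le.mp (h.2.trans hlen)⟩

variable (p₀ A B l₀) in
/-- The agent has not yet been at `home` when phase `i` starts, and it is then at `v`. -/
def Survives (home : ℤ × ℤ) (x : ℕ → Outcome) (z : ℕ → ℕ) (i : ℕ) (v : ℤ × ℤ) : Prop :=
  (∀ j < i, z j ∈ Finset.Icc 1 (maxShift p₀ (startTime p₀ A B l₀.length j))) ∧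
    (∀ s ≤ startTime p₀ A B l₀.length i, posAt p₀ A B l₀ x z i s ≠ home) ∧
    posAt p₀ A B l₀ x z i (startTime p₀ A B l₀.length i) = v

/-- This is the Markov structure of the survival event: up to phase `i` it depends on the past, and
then only on the position `v`, the shift and the outcomes of the new phase. -/
theorem Survives.exists_of_succ {home : ℤ × ℤ} {x : ℕ → Outcome} {z : ℕ → ℕ} {i : ℕ}
    {y : ℤ × ℤ} (h : Survives p₀ A B l₀ home x z (i + 1) y) :
    ∃ v ∈ reachable (startTime p₀ A B l₀.length i), Survives p₀ A B l₀ home x z i v ∧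
      z i ∈ Finset.Icc 1 (maxShift p₀ (startTime p₀ A B l₀.length i)) ∧
      ¬ Hits v home (phase p₀ A B (startTime p₀ A B l₀.length i) (z i))
        (outcomeWord x (startTime p₀ A B l₀.length i)
          (phaseLength p₀ A B (startTime p₀ A B l₀.length i))) ∧
      v + agentDisp (phase p₀ A B (startTime p₀ A B l₀.length i) (z i))
        (outcomeWord x (startTime p₀ A B l₀.length i)
          (phaseLength p₀ A B (startTime p₀ A B l₀.length i))) = y := by
  obtain ⟨hz, havoid, hy⟩ := h
  have hlen : (moves p₀ A B l₀ z i).length = startTime p₀ A B l₀.length i :=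
    length_moves fun j hj => (Finset.mem_Icc.mp (hz j (by omega))).2
  have hzi := hz i (by omega)
  have hph : (phase p₀ A B (startTime p₀ A B l₀.length i) (z i)).length =
      phaseLength p₀ A B (startTime p₀ A B l₀.length i) :=
    length_phase _ _ _ _ _ (Finset.mem_Icc.mp hzi).2
  refine ⟨_, posAt_mem_reachable x z i _, ⟨fun j hj => hz j (by omega), fun s hs => ?_, rfl⟩,
    hzi, ?_, ?_⟩
  · rw [← posAt_succ_of_le x (hs.trans hlen.ge)]
    exact havoid s (hs.trans (by rw [startTime]; omega))
  · rintro ⟨k, hk, hhome⟩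
    rw [hph] at hk
    rw [take_outcomeWord _ _ hk, ← posAt_succ_add x hlen] at hhome
    exact havoid _ (by rw [startTime]; omega) hhome
  · rw [← hy, startTime, posAt_succ_add x hlen, ← hph, List.take_length]

theorem Survives.congr {home : ℤ × ℤ} {x x' : ℕ → Outcome} {z z' : ℕ → ℕ} {i : ℕ} {v : ℤ × ℤ}
    (hx : ∀ s < startTime p₀ A B l₀.length i, x s = x' s) (hz : ∀ j < i, z j = z' j)
    (h : Survives p₀ A B l₀ home x z i v) : Survives p₀ A B l₀ home x' z' i v := by
  have hpos : ∀ s ≤ startTime p₀ A B l₀.length i,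
      posAt p₀ A B l₀ x z i s = posAt p₀ A B l₀ x' z' i s := by
    intro s hs
    rw [posAt, posAt, moves_congr hz, outcomeWord_congr (x := x) (x' := x')]
    intro r hr
    exact hx r (by omega)
  obtain ⟨h1, h2, h3⟩ := h
  refine ⟨fun j hj => hz j hj ▸ h1 j hj, fun s hs => hpos s hs ▸ h2 s hs, ?_⟩
  rw [← hpos _ le_rfl, h3]

variable {Ω : Type*} [mΩ : MeasurableSpace Ω] {μ : Measure Ω}
  {p : ℝ} {ξ : ℕ → Ω → Outcome} {Z : ℕ → Ω → ℕ}

variable (p₀ A B l₀ μ ξ Z) in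
/-- The sum of `φ` over the positions at the start of phase `i`, weighted with the probability
that the agent is there and has not yet been at `home`. -/
noncomputable def survivalMean (home : ℤ × ℤ) (i : ℕ) (φ : ℤ × ℤ → ℝ) : ℝ :=
  ∑ v ∈ reachable (startTime p₀ A B l₀.length i),
    μ.real {ω | Survives p₀ A B l₀ home (fun s => ξ s ω) (fun j => Z j ω) i v} * φ v

theorem survivalMean_mono (home : ℤ × ℤ) (i : ℕ) {φ ψ : ℤ × ℤ → ℝ} (h : ∀ v, φ v ≤ ψ v) :
    survivalMean p₀ A B l₀ μ ξ Z home i φ ≤ survivalMean p₀ A B l₀ μ ξ Z home i ψ :=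
  Finset.sum_le_sum fun v _ => mul_le_mul_of_nonneg_left (h v) measureReal_nonneg

/-- One phase of the walk. -/
theorem IsSweepingRandomness.survivalMean_succ_le [IsProbabilityMeasure μ]
    (h : IsSweepingRandomness μ p p₀ A B l₀.length ξ Z) (hp : 0 ≤ p) (hp1 : p ≤ 1)
    (home : ℤ × ℤ) (i : ℕ) {φ : ℤ × ℤ → ℝ} (hφ : ∀ v, 0 ≤ φ v) {t : ℕ}
    (ht : t = startTime p₀ A B l₀.length i) :
    survivalMean p₀ A B l₀ μ ξ Z home (i + 1) φ ≤
      survivalMean p₀ A B l₀ μ ξ Z home i fun v => (∑ z ∈ Finset.Icc 1 (maxShift p₀ t),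
        wordMean p (phaseLength p₀ A B t) (fun w =>
          ind (¬ Hits v home (phase p₀ A B t z) w) *
            φ (v + agentDisp (phase p₀ A B t z) w))) / maxShift p₀ t := by
  set S : ℕ → ℤ × ℤ → Set Ω := fun i v =>
    {ω | Survives p₀ A B l₀ home (fun s => ξ s ω) (fun j => Z j ω) i v} with hS
  set M := maxShift p₀ t with hM
  set L := phaseLength p₀ A B t with hL
  have hmeas : ∀ v, MeasurableSet[pastSigma ξ Z t i] (S i v) := fun v =>
    measurableSet_pastSigma (Q := fun x z => Survives p₀ A B l₀ home x z i v)
      fun x x' z z' hx hz => Survives.congr (ht ▸ hx) hz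
  have hmeas' : ∀ v z, MeasurableSet[pastSigma ξ Z t (i + 1)] (S i v ∩ {ω | Z i ω = z}) := by
    intro v z
    refine measurableSet_pastSigma (Q := fun x y => Survives p₀ A B l₀ home x y i v ∧ y i = z) ?_
    intro x x' y y' hx hy ⟨h1, h2⟩
    exact ⟨h1.congr (ht ▸ hx) fun j hj => hy j (by omega), (hy i (by omega)) ▸ h2⟩
  have hstep : ∀ y, μ.real (S (i + 1) y) ≤ ∑ v ∈ reachable t, ∑ z ∈ Finset.Icc 1 M,
      μ.real (S i v) / M * wordMean p L (fun w => ind (¬ Hits v home (phase p₀ A B t z) w ∧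
        v + agentDisp (phase p₀ A B t z) w = y)) := by
    intro y
    -- An inclusion is enough, since only an upper bound is sought.
    have hsub : S (i + 1) y ⊆ ⋃ v ∈ reachable t, ⋃ z ∈ Finset.Icc 1 M,
        (S i v ∩ {ω | Z i ω = z}) ∩ {ω | ¬ Hits v home (phase p₀ A B t z)
          (outcomeWord (fun s => ξ s ω) t L) ∧
          v + agentDisp (phase p₀ A B t z) (outcomeWord (fun s => ξ s ω) t L) = y} := by
      intro ω hω
      obtain ⟨v, hv, h1, h2, h3, h4⟩ := Survives.exists_of_succ hω
      rw [← ht] at hv h2 h3 h4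
      simp only [Set.mem_iUnion]
      exact ⟨v, hv, _, h2, ⟨h1, rfl⟩, h3, h4⟩
    refine (measureReal_mono hsub (measure_ne_top _ _)).trans ((measureReal_biUnion_finset_le _ _).trans ?_)
    refine Finset.sum_le_sum fun v _ => (measureReal_biUnion_finset_le _ _).trans_eq ?_
    refine Finset.sum_congr rfl fun z hz => ?_
    rw [h.measureReal_inter_word hp hp1 (hmeas' v z) L (fun w =>
      ¬ Hits v home (phase p₀ A B t z) w ∧ v + agentDisp (phase p₀ A B t z) w = y)]
    have hz' := hz
    rw [hM, ht] at hz'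
    rw [h.measureReal_inter_shift (hmeas v) hz', ← ht]
  calc survivalMean p₀ A B l₀ μ ξ Z home (i + 1) φ
      ≤ ∑ y ∈ reachable (startTime p₀ A B l₀.length (i + 1)), (∑ v ∈ reachable t,
          ∑ z ∈ Finset.Icc 1 M, μ.real (S i v) / M * wordMean p L (fun w =>
          ind (¬ Hits v home (phase p₀ A B t z) w ∧
            v + agentDisp (phase p₀ A B t z) w = y))) * φ y :=
        Finset.sum_le_sum fun y _ => mul_le_mul_of_nonneg_right (hstep y) (hφ y)
    _ = ∑ v ∈ reachable t, ∑ z ∈ Finset.Icc 1 M, μ.real (S i v) / M * wordMean p L (fun w =>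
          ∑ y ∈ reachable (startTime p₀ A B l₀.length (i + 1)), φ y *
          ind (¬ Hits v home (phase p₀ A B t z) w ∧
            v + agentDisp (phase p₀ A B t z) w = y)) := by
        simp only [wordMean_sum, wordMean_mul_left, Finset.sum_mul, Finset.mul_sum]
        rw [Finset.sum_comm]
        refine Finset.sum_congr rfl fun v _ => ?_
        rw [Finset.sum_comm]
        refine Finset.sum_congr rfl fun z _ => Finset.sum_congr rfl fun y _ => ?_
        ring
    _ ≤ ∑ v ∈ reachable t, ∑ z ∈ Finset.Icc 1 M, μ.real (S i v) / M * wordMean p L (fun w =>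
          ind (¬ Hits v home (phase p₀ A B t z) w) * φ (v + agentDisp (phase p₀ A B t z) w)) := by
        refine Finset.sum_le_sum fun v _ => Finset.sum_le_sum fun z _ => ?_
        refine mul_le_mul_of_nonneg_left (wordMean_mono hp hp1 fun w _ => ?_)
          (div_nonneg measureReal_nonneg (Nat.cast_nonneg _))
        by_cases hH : Hits v home (phase p₀ A B t z) w
        · simp [ind, hH]
        · simp only [ind, hH, not_false_eq_true, true_and, if_true, one_mul, mul_ite, mul_one,
            mul_zero, Finset.sum_ite_eq]
          split_ifs
          · exact le_rfl
          · exact hφ _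
    _ = _ := by
        rw [survivalMean, ← ht]
        refine Finset.sum_congr rfl fun v _ => ?_
        rw [Finset.sum_div, Finset.mul_sum]
        refine Finset.sum_congr rfl fun z _ => ?_
        simp only [hS]
        ring

/-- The probability of not having found `home` at the start of a phase. -/
theorem IsSweepingRandomness.measureReal_lt_sweepingTime_le [IsProbabilityMeasure μ]
    (h : IsSweepingRandomness μ p p₀ A B l₀.length ξ Z) (hp₀' : p₀ < 1) (hA : 0 < A)
    (hl₀ : 0 < l₀.length) (home : ℤ × ℤ) (i : ℕ) :
    μ.real {ω | (startTime p₀ A B l₀.length i : ℕ∞) < sweepingTime p₀ A B l₀ ξ Z home ω} ≤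
      survivalMean p₀ A B l₀ μ ξ Z home i fun _ => 1 := by
  have hae := h.ae_shift_mem fun i => maxShift_pos (startTime_pos hl₀ i)
  have hle : ({ω | (startTime p₀ A B l₀.length i : ℕ∞) < sweepingTime p₀ A B l₀ ξ Z home ω} :
      Set Ω) ≤ᵐ[μ] (⋃ v ∈ reachable (startTime p₀ A B l₀.length i),
        {ω | Survives p₀ A B l₀ home (fun s => ξ s ω) (fun j => Z j ω) i v} : Set Ω) := by
    filter_upwards [hae] with ω hω
    intro (hlt : (startTime p₀ A B l₀.length i : ℕ∞) < sweepingTime p₀ A B l₀ ξ Z home ω)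
    have hlen : (moves p₀ A B l₀ (fun j => Z j ω) i).length = startTime p₀ A B l₀.length i :=
      length_moves fun j _ => (Finset.mem_Icc.mp (hω j)).2
    change ω ∈ (⋃ v ∈ reachable (startTime p₀ A B l₀.length i),
        {ω | Survives p₀ A B l₀ home (fun s => ξ s ω) (fun j => Z j ω) i v} : Set Ω)
    simp only [Set.mem_iUnion]
    refine ⟨_, posAt_mem_reachable _ _ i _, fun j _ => hω j, fun s hs hhome => ?_, rfl⟩
    rw [← guidedWalk_sweepingInstructions hp₀' hA hl₀ _ _ (hs.trans hlen.ge)] at hhome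
    refine absurd hlt (not_lt.mpr ?_)
    refine (iInf₂_le s hhome).trans ?_
    exact_mod_cast hs
  refine (ENNReal.toReal_mono (measure_ne_top _ _) (measure_mono_ae hle)).trans ?_
  refine (measureReal_biUnion_finset_le _ _).trans_eq ?_
  simp only [survivalMean, mul_one]

end Walk

/-! ### Decay of the survival probability -/

section Decay

variable {p₀ A B p : ℝ} {l₀ : List Dir} {Ω : Type*} [mΩ : MeasurableSpace Ω] {μ : Measure Ω}
  {ξ : ℕ → Ω → Outcome} {Z : ℕ → Ω → ℕ}

theorem survivalMean_mul_left (home : ℤ × ℤ) (i : ℕ) (c : ℝ) (φ : ℤ × ℤ → ℝ) :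
    survivalMean p₀ A B l₀ μ ξ Z home i (fun v => c * φ v) =
      c * survivalMean p₀ A B l₀ μ ξ Z home i φ := by
  rw [survivalMean, survivalMean, Finset.mul_sum]
  exact Finset.sum_congr rfl fun v _ => by ring

theorem survivalMean_add (home : ℤ × ℤ) (i : ℕ) (φ ψ : ℤ × ℤ → ℝ) :
    survivalMean p₀ A B l₀ μ ξ Z home i (fun v => φ v + ψ v) =
      survivalMean p₀ A B l₀ μ ξ Z home i φ + survivalMean p₀ A B l₀ μ ξ Z home i ψ := by
  rw [survivalMean, survivalMean, survivalMean, ← Finset.sum_add_distrib]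
  exact Finset.sum_congr rfl fun v _ => by ring

theorem survivalMean_sum {ι : Type*} (T : Finset ι) (home : ℤ × ℤ) (i : ℕ)
    (φ : ι → ℤ × ℤ → ℝ) :
    survivalMean p₀ A B l₀ μ ξ Z home i (fun v => ∑ e ∈ T, φ e v) =
      ∑ e ∈ T, survivalMean p₀ A B l₀ μ ξ Z home i (φ e) := by
  simp only [survivalMean, Finset.mul_sum]
  rw [Finset.sum_comm]

/-- The growth of an exponential moment during one phase. -/
theorem IsSweepingRandomness.survivalMean_exp_succ_le [IsProbabilityMeasure μ]
    (h : IsSweepingRandomness μ p p₀ A B l₀.length ξ Z) (hp : 0 ≤ p) (hp1 : p ≤ 1)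
    (home : ℤ × ℤ) (i : ℕ) {t : ℕ} (ht : t = startTime p₀ A B l₀.length i) (ht0 : 0 < t)
    {s c : ℝ} (hs : 0 ≤ s) (hs1 : s ≤ 1 / 2) (e : Dir)
    (hc : ∀ z ≤ maxShift p₀ t,
      ((phase p₀ A B t z).map (stepVar p e)).sum ≤ c * phaseLength p₀ A B t) :
    survivalMean p₀ A B l₀ μ ξ Z home (i + 1) (fun v => Real.exp (s * e.comp v)) ≤
      Real.exp (s ^ 2 * ((c / 2 + 8 * s) * phaseLength p₀ A B t)) *
        survivalMean p₀ A B l₀ μ ξ Z home i (fun v => Real.exp (s * e.comp v)) := by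
  refine (h.survivalMean_succ_le hp hp1 home i (fun v => (Real.exp_pos _).le) ht).trans ?_
  rw [← survivalMean_mul_left]
  refine survivalMean_mono home i fun v => ?_
  set E := Real.exp (s ^ 2 * ((c / 2 + 8 * s) * phaseLength p₀ A B t)) with hE
  have hM : (0 : ℝ) < maxShift p₀ t := by exact_mod_cast maxShift_pos ht0
  rw [div_le_iff₀ hM]
  have hterm : ∀ z ∈ Finset.Icc 1 (maxShift p₀ t),
      wordMean p (phaseLength p₀ A B t) (fun w => ind (¬ Hits v home (phase p₀ A B t z) w) *
        Real.exp (s * e.comp (v + agentDisp (phase p₀ A B t z) w))) ≤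
      E * Real.exp (s * e.comp v) := by
    intro z hz
    have hzM := (Finset.mem_Icc.mp hz).2
    have h1 := wordMean_exp_le hp hp1 hs hs1 e (phase p₀ A B t z)
    -- Since a phase is a closed walk, the mean displacement vanishes and the exponential moment
    -- grows only through the variance.
    rw [length_phase p₀ A B t z hzM, displacement_phase] at h1
    calc _ ≤ wordMean p (phaseLength p₀ A B t) (fun w => Real.exp (s * e.comp v) *
          Real.exp (s * ((e.comp (agentDisp (phase p₀ A B t z) w) : ℝ) -
            (1 - p) * e.comp (0 : ℤ × ℤ)))) := by
          refine wordMean_mono hp hp1 fun w _ => ?_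
          refine (mul_le_of_le_one_left (Real.exp_pos _).le (ind_le_one _)).trans_eq ?_
          rw [← Real.exp_add, Dir.comp_add]
          simp only [Dir.comp, Prod.fst_zero, Prod.snd_zero]
          push_cast
          ring_nf
      _ = Real.exp (s * e.comp v) * wordMean p (phaseLength p₀ A B t) (fun w =>
          Real.exp (s * ((e.comp (agentDisp (phase p₀ A B t z) w) : ℝ) -
            (1 - p) * e.comp (0 : ℤ × ℤ)))) := wordMean_mul_left _ _ _
      _ ≤ Real.exp (s * e.comp v) * E := by
          refine mul_le_mul_of_nonneg_left (h1.trans (Real.exp_le_exp.mpr ?_)) (Real.exp_pos _).le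
          refine mul_le_mul_of_nonneg_left ?_ (sq_nonneg s)
          have := hc z hzM
          linarith
      _ = _ := mul_comm _ _
  refine (Finset.sum_le_sum hterm).trans_eq ?_
  rw [Finset.sum_const, Nat.card_Icc, Nat.add_sub_cancel, nsmul_eq_mul, mul_comm]

/-- The decrease of the survival probability during one phase. -/
theorem IsSweepingRandomness.survivalMean_one_succ_le [IsProbabilityMeasure μ]
    (h : IsSweepingRandomness μ p p₀ A B l₀.length ξ Z) (hp : 0 ≤ p) (hp1 : p ≤ 1)
    (home : ℤ × ℤ) (i : ℕ) {t : ℕ} (ht : t = startTime p₀ A B l₀.length i) (ht0 : 0 < t)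
    {η : ℝ} (hη : η ≤ 1) {r s : Dir → ℝ} {γ : ℝ} (hs : ∀ e, 0 ≤ s e)
    (hγ : ∀ e, γ = Real.exp (-(s e * r e)))
    (hhit : ∀ x : ℤ × ℤ, (∀ e : Dir, (e.comp x : ℝ) ≤ r e) →
      1 - η ≤ ∑ z ∈ Finset.Icc 1 (maxShift p₀ t),
        wordMean p (phaseLength p₀ A B t) (fun ω => ind (Hits x home (phase p₀ A B t z) ω))) :
    survivalMean p₀ A B l₀ μ ξ Z home (i + 1) (fun _ => 1) ≤
      (1 - (1 - η) / maxShift p₀ t) * survivalMean p₀ A B l₀ μ ξ Z home i (fun _ => 1) +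
      (1 - η) / maxShift p₀ t * (γ * ∑ e, survivalMean p₀ A B l₀ μ ξ Z home i
        (fun v => Real.exp (s e * e.comp v))) := by
  have hM : (0 : ℝ) < maxShift p₀ t := by exact_mod_cast maxShift_pos ht0
  set κ := (1 - η) / maxShift p₀ t with hκ
  have hκ0 : 0 ≤ κ := div_nonneg (by linarith) hM.le
  have hγ0 : 0 < γ := by rw [hγ .east]; exact Real.exp_pos _
  refine (h.survivalMean_succ_le hp hp1 home i (fun v => zero_le_one) ht).trans ?_
  rw [← survivalMean_sum, ← survivalMean_mul_left, ← survivalMean_mul_left,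
    ← survivalMean_mul_left, ← survivalMean_add]
  refine survivalMean_mono home i fun v => ?_
  have hsplit : ∑ z ∈ Finset.Icc 1 (maxShift p₀ t), wordMean p (phaseLength p₀ A B t)
      (fun w => ind (¬ Hits v home (phase p₀ A B t z) w) * 1) = maxShift p₀ t -
      ∑ z ∈ Finset.Icc 1 (maxShift p₀ t), wordMean p (phaseLength p₀ A B t)
        (fun w => ind (Hits v home (phase p₀ A B t z) w)) := by
    have h1 : ∀ z ∈ Finset.Icc 1 (maxShift p₀ t), wordMean p (phaseLength p₀ A B t)
        (fun w => ind (¬ Hits v home (phase p₀ A B t z) w) * 1) = 1 -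
        wordMean p (phaseLength p₀ A B t) (fun w => ind (Hits v home (phase p₀ A B t z) w)) := by
      intro z _
      refine Eq.trans (wordMean_congr
        (ψ := fun w => 1 - ind (Hits v home (phase p₀ A B t z) w)) fun w _ => ?_)
        (by rw [wordMean_sub, wordMean_const])
      by_cases hH : Hits v home (phase p₀ A B t z) w <;> simp [ind, hH]
    rw [Finset.sum_congr rfl h1, Finset.sum_sub_distrib, Finset.sum_const, Nat.card_Icc,
      Nat.add_sub_cancel, nsmul_eq_mul, mul_one]
  rw [hsplit, sub_div, div_self hM.ne', mul_one]
  have hsum0 : 0 ≤ ∑ e, Real.exp (s e * e.comp v) :=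
    Finset.sum_nonneg fun e _ => (Real.exp_pos _).le
  -- Inside the box the sweep succeeds with probability at least `κ`. Outside, one of the four
  -- exponentials outweighs `γ`, and the claimed bound is at least the trivial bound `1`.
  by_cases hgood : ∀ e : Dir, (e.comp v : ℝ) ≤ r e
  · have h1 : κ ≤ (∑ z ∈ Finset.Icc 1 (maxShift p₀ t), wordMean p (phaseLength p₀ A B t)
        (fun w => ind (Hits v home (phase p₀ A B t z) w))) / maxShift p₀ t :=
      div_le_div_of_nonneg_right (hhit v hgood) hM.le
    have h2 : 0 ≤ κ * (γ * ∑ e, Real.exp (s e * e.comp v)) := by positivity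
    linarith
  · push Not at hgood
    obtain ⟨e, he⟩ := hgood
    have h1 : 1 ≤ γ * ∑ e, Real.exp (s e * e.comp v) := by
      calc 1 ≤ γ * Real.exp (s e * e.comp v) := by
            rw [hγ e, ← Real.exp_add]
            refine Real.one_le_exp ?_
            nlinarith [mul_nonneg (hs e) (sub_nonneg.mpr he.le)]
        _ ≤ _ := by
            refine mul_le_mul_of_nonneg_left ?_ hγ0.le
            exact Finset.single_le_sum (f := fun e : Dir => Real.exp (s e * e.comp v))
              (fun e _ => (Real.exp_pos _).le) (Finset.mem_univ e)
    have h2 : 0 ≤ (∑ z ∈ Finset.Icc 1 (maxShift p₀ t), wordMean p (phaseLength p₀ A B t)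
        (fun w => ind (Hits v home (phase p₀ A B t z) w))) / maxShift p₀ t := by
      refine div_nonneg (Finset.sum_nonneg fun z _ => ?_) hM.le
      rw [← wordMean_const (p := p) (phaseLength p₀ A B t) 0]
      exact wordMean_mono hp hp1 fun w _ => ind_nonneg _
    nlinarith

/-- Interpolation between the survival probability and an exponential moment. -/
theorem survivalMean_exp_mul_le (home : ℤ × ℤ) (i : ℕ) (e : Dir) {s ρ K : ℝ} (hK : 0 < K)
    (hρ0 : 0 ≤ ρ) (hρ1 : ρ ≤ 1) :
    survivalMean p₀ A B l₀ μ ξ Z home i (fun v => Real.exp (ρ * s * e.comp v)) ≤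
      ρ * K ^ (ρ - 1) * survivalMean p₀ A B l₀ μ ξ Z home i (fun v => Real.exp (s * e.comp v)) +
      (1 - ρ) * K ^ ρ * survivalMean p₀ A B l₀ μ ξ Z home i (fun _ => 1) := by
  rw [← survivalMean_mul_left, ← survivalMean_mul_left, ← survivalMean_add]
  refine survivalMean_mono home i fun v => ?_
  set y := Real.exp (s * e.comp v) with hy
  have hy0 : 0 < y := Real.exp_pos _
  -- Weighted AM-GM for `y / K` and `1` gives `y ^ ρ ≤ K ^ ρ * (ρ * y / K + 1 - ρ)`. It is sharp at
  -- `y = K`, the anticipated ratio of the moment to the survival probability.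
  have h1 := Real.geom_mean_le_arith_mean2_weighted hρ0 (sub_nonneg.mpr hρ1)
    (div_nonneg hy0.le hK.le) zero_le_one (by ring)
  rw [Real.one_rpow, mul_one, Real.div_rpow hy0.le hK.le, mul_one,
    div_le_iff₀ (Real.rpow_pos_of_pos hK _)] at h1
  have h2 : Real.exp (ρ * s * e.comp v) = y ^ ρ := by
    rw [hy, ← Real.exp_mul]; ring_nf
  rw [h2, Real.rpow_sub_one hK.ne']
  refine h1.trans_eq ?_
  field_simp

end Decay

/-- The variance of a step, relative to the square of the drift, increases with the probability
of a mistake. -/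
theorem stepVar_mul_sq_le {p p₀ : ℝ} (hpp₀ : p ≤ p₀) (hp₀' : p₀ < 1) :
    p / 2 * (3 - 2 * p) ≤ ((1 - p) / (1 - p₀)) ^ 2 * (p₀ / 2 * (3 - 2 * p₀)) := by
  have hq : 0 < 1 - p₀ := sub_pos.mpr hp₀'
  rw [div_pow, div_mul_eq_mul_div ((1 - p) ^ 2), le_div_iff₀ (by positivity)]
  -- With `u = 1 - p`, the ratio `p * (3 - 2 * p) / u ^ 2` equals `u⁻² + u⁻¹ - 2`, which decreases
  -- in `u`. The product is the resulting difference for `p₀` and `p`, with denominators cleared.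
  have h1 : 0 ≤ (p₀ - p) * ((2 - p₀) * (2 - p) - 1) :=
    mul_nonneg (by linarith) (by nlinarith)
  nlinarith

/-- The total variance of a phase, in units of the squared half-width of the swept box. -/
theorem eventually_sum_stepVar_le {p₀ A B p a ε : ℝ} (hp₀ : 0 < p₀) (hp₀' : p₀ < 1) (ha : 0 < a)
    (hA : A = a * √(p₀ / 2) * √(3 - 2 * p₀)) (hB : B = a * √(p₀ / 2))
    (hp : 0 ≤ p) (hpp₀ : p ≤ p₀) (hε : 0 < ε) (e : Dir) :
    ∀ᶠ t : ℕ in atTop, ∀ z ≤ maxShift p₀ t,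
      ((phase p₀ A B t z).map (stepVar p e)).sum ≤
        (((1 - p) / (1 - p₀) * boxExtent A B e) ^ 2 / a ^ 2 + ε) * phaseLength p₀ A B t := by
  have hA0 : 0 < A := by
    rw [hA]
    have h1 : 0 < 3 - 2 * p₀ := by linarith
    positivity
  have hB0 : 0 < B := by rw [hB]; positivity
  have hq : 0 < 1 - p₀ := sub_pos.mpr hp₀'
  have hB2 : B ^ 2 = a ^ 2 * (p₀ / 2) := by rw [hB, mul_pow, Real.sq_sqrt (by linarith)]
  have hA2 : A ^ 2 = a ^ 2 * (p₀ / 2 * (3 - 2 * p₀)) := by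
    rw [hA, mul_pow, mul_pow, Real.sq_sqrt (by linarith), Real.sq_sqrt (by linarith)]; ring
  -- Vertically, almost every step has variance `p / 2`, and `ε` pays for the rest. Horizontally, `p
  -- / 2 * (3 - 2 * p)` bounds every step.
  by_cases he : e.Vertical
  · have hκ : 1 ≤ ((1 - p) / (1 - p₀)) ^ 2 := by
      refine one_le_pow₀ ?_
      rw [le_div_iff₀ hq]; linarith
    have hext : ((1 - p) / (1 - p₀) * boxExtent A B e) ^ 2 / a ^ 2 =
        ((1 - p) / (1 - p₀)) ^ 2 * (p₀ / 2) := by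
      rw [boxExtent, if_pos he, mul_pow, hB2]; field_simp
    filter_upwards [eventually_vertical_le hp₀' hA0 hB0 hε] with t ht z hz
    have h1 := sum_stepVar_vertical_le hp (by linarith) he (phase p₀ A B t z)
    have h2 : (verticalCount (phase p₀ A B t z) : ℝ) ≤
        2 * (boxH p₀ B t + maxShift p₀ t + numLines p₀ B t * gap p₀ t) := by
      exact_mod_cast verticalCount_phase_le p₀ A B t z hz
    rw [length_phase p₀ A B t z hz] at h1
    rw [hext, add_mul]
    have h3 : p / 2 * (phaseLength p₀ A B t : ℝ) ≤
        ((1 - p) / (1 - p₀)) ^ 2 * (p₀ / 2) * phaseLength p₀ A B t := by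
      gcongr
      nlinarith
    linarith
  · have hext : ((1 - p) / (1 - p₀) * boxExtent A B e) ^ 2 / a ^ 2 =
        ((1 - p) / (1 - p₀)) ^ 2 * (p₀ / 2 * (3 - 2 * p₀)) := by
      rw [boxExtent, if_neg he, mul_pow, hA2]; field_simp
    refine Eventually.of_forall fun t z hz => ?_
    have h1 := sum_stepVar_le (l := phase p₀ A B t z) (p := p) (e := e)
      (c := p / 2 * (3 - 2 * p)) (fun d => by
        rw [stepVar_eq]
        split_ifs
        · exact le_rfl
        · nlinarith)
    rw [length_phase p₀ A B t z hz] at h1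
    refine h1.trans (mul_le_mul_of_nonneg_right ?_ (Nat.cast_nonneg _))
    rw [hext]
    linarith [stepVar_mul_sq_le hpp₀ hp₀']

theorem tendsto_startTime {p₀ A B : ℝ} {l₀ : List Dir} (hp₀' : p₀ < 1) (hA : 0 < A)
    (hl₀ : 0 < l₀.length) : Tendsto (startTime p₀ A B l₀.length) atTop atTop :=
  (strictMono_nat_of_lt_succ (startTime_lt_succ hp₀' hA hl₀)).tendsto_atTop

/-- The condition of the theorem still holds with some room to spare. -/
theorem exists_slack {a α c : ℝ} (h : (1 - 4 * Real.exp (-a ^ 2 / 4 + 2 * α)) * c > α) :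
    ∃ ε, 0 < ε ∧ ε < 1 ∧ α < (1 - 4 * Real.exp (-((1 - ε) * a ^ 2 / 2)) *
      Real.exp (2 * ((1 + ε) * a ^ 2 / 8) + 2 * α + ε)) * (1 - ε) * c := by
  have hcont : Continuous fun ε : ℝ => (1 - 4 * Real.exp (-((1 - ε) * a ^ 2 / 2)) *
      Real.exp (2 * ((1 + ε) * a ^ 2 / 8) + 2 * α + ε)) * (1 - ε) * c := by fun_prop
  -- At `ε = 0` the exponents combine to `-a² / 2 + a² / 4 + 2 α`, which gives the hypothesis;
  -- continuity in `ε` does the rest.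
  have h0 : α < (1 - 4 * Real.exp (-((1 - (0 : ℝ)) * a ^ 2 / 2)) *
      Real.exp (2 * ((1 + 0) * a ^ 2 / 8) + 2 * α + 0)) * (1 - 0) * c := by
    rw [mul_assoc 4, ← Real.exp_add, show -((1 - (0 : ℝ)) * a ^ 2 / 2) +
      (2 * ((1 + 0) * a ^ 2 / 8) + 2 * α + 0) = -a ^ 2 / 4 + 2 * α by ring, sub_zero, mul_one]
    exact h
  have hev := (hcont.tendsto 0).eventually_const_lt h0
  have hev2 : ∀ᶠ ε : ℝ in nhds 0, ε < 1 := eventually_lt_nhds one_pos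
  have hall := ((hev.and hev2).filter_mono nhdsWithin_le_nhds).and
    (self_mem_nhdsWithin (a := (0 : ℝ)) (s := Set.Ioi 0))
  obtain ⟨ε, ⟨h1, h2⟩, h3⟩ := hall.exists
  exact ⟨ε, h3, h2, h1⟩

/-! ### Decay along the phases, the tail for all times, and the mean -/

section Final

variable {p₀ A B p : ℝ} {l₀ : List Dir} {Ω : Type*} [mΩ : MeasurableSpace Ω] {μ : Measure Ω}
  [IsProbabilityMeasure μ] {ξ : ℕ → Ω → Outcome} {Z : ℕ → Ω → ℕ}

set_option maxHeartbeats 1000000 in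
/-- The decay of the survival probabilities at the starting times of the phases. -/
theorem IsSweepingRandomness.exists_survivalMean_le
    (h : IsSweepingRandomness μ p p₀ A B l₀.length ξ Z) {α a : ℝ}
    (hp₀ : 0 < p₀) (hp₀' : p₀ < 1) (hα : 0 < α) (ha : 0 < a)
    (hcond : (1 - 4 * Real.exp (-a ^ 2 / 4 + 2 * α)) *
      ((1 - p₀) ^ 2 / (2 * a ^ 2 * p₀ * √(3 - 2 * p₀))) > α)
    (hA : A = a * √(p₀ / 2) * √(3 - 2 * p₀)) (hB : B = a * √(p₀ / 2))
    (hp : 0 ≤ p) (hpp₀ : p ≤ p₀) (hl₀ : 0 < l₀.length) (home : ℤ × ℤ) :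
    ∃ C i₀, ∀ i ≥ i₀, survivalMean p₀ A B l₀ μ ξ Z home i (fun _ => 1) ≤
      C * (startTime p₀ A B l₀.length i : ℝ) ^ (-α) := by
  have h3 : 0 < 3 - 2 * p₀ := by linarith
  have hq : 0 < 1 - p₀ := sub_pos.mpr hp₀'
  have hp1 : p < 1 := by linarith
  have hqp : 0 < 1 - p := sub_pos.mpr hp1
  have hA0 : 0 < A := by rw [hA]; positivity
  have hB0 : 0 < B := by rw [hB]; positivity
  obtain ⟨ε, hε0, hε1, hε⟩ := exists_slack hcond
  set b := (1 + ε) * a ^ 2 / 8 with hb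
  set γ := Real.exp (-((1 - ε) * a ^ 2 / 2)) with hγ
  set K := Real.exp (2 * b + 2 * α + ε) with hK
  have hK0 : 0 < K := Real.exp_pos _
  set c := (1 - p₀) ^ 2 / (2 * a ^ 2 * p₀ * √(3 - 2 * p₀)) with hc
  have hc0 : 0 < c := by positivity
  have hAB : 4 * A * B / (1 - p₀) ^ 2 = 1 / c := by
    have h4 : 4 * A * B = 2 * a ^ 2 * p₀ * √(3 - 2 * p₀) := by
      rw [hA, hB]
      have := Real.mul_self_sqrt (show 0 ≤ p₀ / 2 by linarith)
      calc _ = 4 * a ^ 2 * (√(p₀ / 2) * √(p₀ / 2)) * √(3 - 2 * p₀) := by ring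
        _ = _ := by rw [this]; ring
    rw [hc, h4, one_div_div]
  set τ : ℕ → ℕ := startTime p₀ A B l₀.length with hτ
  have hτt : Tendsto τ atTop atTop := tendsto_startTime hp₀' hA0 hl₀
  have hτ0 : ∀ i, 0 < τ i := startTime_pos hl₀
  have hτ0R : ∀ i, (0 : ℝ) < τ i := fun i => by exact_mod_cast hτ0 i
  have hτs : ∀ i, (τ (i + 1) : ℝ) = τ i + phaseLength p₀ A B (τ i) := fun i => by
    rw [hτ, startTime]; push_cast; rfl
  set r : Dir → ℝ := fun e => (1 - p) / (1 - p₀) * boxExtent A B e with hr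
  have hr0 : ∀ e, 0 < r e := by
    intro e
    simp only [hr, boxExtent]
    split_ifs <;> positivity
  -- For an exponent `θ / (r e * √τ)` the Markov factor is about `exp (-θ)` and `2 * b` is about `θ²
  -- / a²`. The product `γ * K` is smallest at `θ = a² / 2`, and this yields `a² / 4` in the
  -- hypothesis.
  set s : Dir → ℕ → ℝ := fun e i => a ^ 2 / (2 * r e * √(τ i : ℝ)) with hs
  have hs0 : ∀ e i, 0 ≤ s e i := fun e i => by have := hr0 e; positivity
  have hst : ∀ e, Tendsto (fun i => s e (i + 1)) atTop (nhds 0) := by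
    intro e
    have h1 : Tendsto (fun i => √(τ (i + 1) : ℝ)) atTop atTop :=
      tendsto_sqrt_nat.comp (hτt.comp (tendsto_add_atTop_nat 1))
    refine (h1.const_div_atTop (a ^ 2 / (2 * r e))).congr fun i => ?_
    rw [hs, div_div]
  set ρ : ℕ → ℝ := fun i => √((τ i : ℝ) / τ (i + 1)) with hρ
  have hρsq : ∀ i, ρ i ^ 2 = (τ i : ℝ) / τ (i + 1) := fun i =>
    Real.sq_sqrt (div_nonneg (hτ0R i).le (hτ0R _).le)
  have hρ0 : ∀ i, 0 < ρ i := fun i => Real.sqrt_pos.mpr (div_pos (hτ0R i) (hτ0R _))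
  have hρ1 : ∀ i, ρ i ≤ 1 := by
    intro i
    refine Real.sqrt_le_one.mpr ?_
    rw [div_le_one (hτ0R _), hτs i]
    have : (0 : ℝ) ≤ phaseLength p₀ A B (τ i) := Nat.cast_nonneg _
    linarith
  have hρt : Tendsto ρ atTop (nhds 1) := by
    have h1 := ((tendsto_phaseLength_div hp₀' hA0 hB0).comp hτt).const_add 1
    rw [add_zero] at h1
    have h2 := (h1.inv₀ one_ne_zero).sqrt
    rw [inv_one, Real.sqrt_one] at h2
    refine h2.congr fun i => ?_
    simp only [hρ, Function.comp]
    congr 1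
    rw [hτs i]
    have := (hτ0R i).ne'
    have h4 : (τ i : ℝ) + phaseLength p₀ A B (τ i) ≠ 0 := by rw [← hτs]; exact (hτ0R _).ne'
    field_simp
  -- the facts that hold eventually
  have ev1 : ∀ᶠ i in atTop, 2 * α ≤ (2 * α + ε) * ρ i := by
    have h1 := hρt.const_mul (2 * α + ε)
    rw [mul_one] at h1
    exact (h1.eventually_const_lt (show 2 * α < 2 * α + ε by linarith)).mono fun i hi => hi.le
  -- With `v = r e ^ 2 / a ^ 2`, half of the slack `ε * v` goes to the variance bound in `ev3` and
  -- half to the cubic error `8 * s`, so that together they give `v * (1 + ε) / 2`.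
  have ev2 : ∀ᶠ i in atTop, ∀ e, s e (i + 1) ≤ 1 / 2 ∧
      16 * s e (i + 1) ≤ ε * (r e ^ 2 / a ^ 2) / 2 := by
    refine eventually_all.mpr fun e => ?_
    have hre := hr0 e
    have h1 := (hst e).eventually_le_const (show (0 : ℝ) < 1 / 2 by norm_num)
    have h2 := (hst e).eventually_le_const
      (show 0 < ε * (r e ^ 2 / a ^ 2) / 2 / 16 by positivity)
    filter_upwards [h1, h2] with i hi1 hi2
    exact ⟨hi1, by linarith⟩
  have ev3 : ∀ᶠ i in atTop, ∀ e, ∀ z ≤ maxShift p₀ (τ i),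
      ((phase p₀ A B (τ i) z).map (stepVar p e)).sum ≤
        (r e ^ 2 / a ^ 2 + ε * (r e ^ 2 / a ^ 2) / 2) * phaseLength p₀ A B (τ i) := by
    refine eventually_all.mpr fun e => ?_
    have hre := hr0 e
    exact hτt.eventually (eventually_sum_stepVar_le hp₀ hp₀' ha hA hB hp hpp₀
      (show 0 < ε * (r e ^ 2 / a ^ 2) / 2 by positivity) e)
  have ev4 := hτt.eventually (eventually_le_sum_hits hp₀' hA0 hB0 hp hp1 hε0 hε0 home)
  -- Here the hypothesis on `a` enters: the limit of the left side is `α / c`.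
  have ev5 : ∀ᶠ i in atTop, α * ((phaseLength p₀ A B (τ i) : ℝ) * maxShift p₀ (τ i) / τ i) ≤
      (1 - 4 * γ * K) * (1 - ε) := by
    have h1 := ((tendsto_phaseLength_mul_maxShift hp₀' hA0 hB0).comp hτt).const_mul α
    rw [hAB] at h1
    refine (h1.eventually_lt_const ?_).mono fun i hi => hi.le
    rw [mul_one_div, div_lt_iff₀ hc0]
    exact hε
  obtain ⟨i₀, hi₀⟩ := eventually_atTop.mp (ev1.and (ev2.and (ev3.and (ev4.and ev5))))
  have hM0 : ∀ i, (0 : ℝ) < maxShift p₀ (τ i) := fun i => by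
    exact_mod_cast maxShift_pos (hτ0 i)
  have hkey := exists_le_rpow_neg (α := α) (b := b) (ε := ε) (γ := γ) (K := K)
    (τ := fun i => (τ i : ℝ)) (f := fun i => survivalMean p₀ A B l₀ μ ξ Z home i (fun _ => 1))
    (h := fun i => (1 - ε) / maxShift p₀ (τ i)) (ρ := ρ)
    (F := fun e i => survivalMean p₀ A B l₀ μ ξ Z home i (fun v => Real.exp (s e i * e.comp v)))
    (i₀ := i₀) hα (by positivity) (Real.exp_pos _).le rfl (fun i _ => hτ0R i) (fun i _ => rfl)
    (fun i _ => hρ0 i) (fun i _ => hρ1 i) (fun i hi => (hi₀ i hi).1)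
    (fun i _ => div_nonneg (by linarith) (hM0 i).le)
    (fun i _ => by
      rw [div_le_one (hM0 i)]
      have : (1 : ℝ) ≤ maxShift p₀ (τ i) := by exact_mod_cast maxShift_pos (hτ0 i)
      linarith)
    ?_ ?_ ?_
  · obtain ⟨C, hC⟩ := hkey
    exact ⟨C, i₀, hC⟩
  · intro i hi e
    obtain ⟨-, hi2, hi3, -, -⟩ := hi₀ i hi
    have hre := hr0 e
    have h1 := h.survivalMean_exp_succ_le hp hp1.le home i rfl (hτ0 i) (hs0 e (i + 1))
      (hi2 e).1 e (hi3 e)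
    have h2 := survivalMean_exp_mul_le (p₀ := p₀) (A := A) (B := B) (l₀ := l₀) (μ := μ) (ξ := ξ)
      (Z := Z) home i e (s := s e i) hK0 (hρ0 i).le (hρ1 i)
    -- The exponents scale like `1 / √τ`, so the new one is exactly `ρ i` times the old one.
    have hsρ : ρ i * s e i = s e (i + 1) := by
      have h4 := Real.sqrt_pos.mpr (hτ0R i)
      have h5 := Real.sqrt_pos.mpr (hτ0R (i + 1))
      simp only [hρ, hs]
      rw [Real.sqrt_div (hτ0R i).le]
      field_simp
    rw [hsρ] at h2
    refine h1.trans ?_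
    rw [mul_comm]
    refine mul_le_mul h2 (Real.exp_le_exp.mpr ?_) (Real.exp_pos _).le ?_
    · have hLρ : 1 - ρ i ^ 2 = phaseLength p₀ A B (τ i) / τ (i + 1) := by
        rw [hρsq, eq_div_iff (hτ0R _).ne', sub_mul, div_mul_cancel₀ _ (hτ0R _).ne', hτs i]
        ring
      have hs2 : s e (i + 1) ^ 2 = a ^ 2 / (4 * (r e ^ 2 / a ^ 2)) / τ (i + 1) := by
        simp only [hs]
        rw [div_pow, mul_pow, mul_pow, Real.sq_sqrt (hτ0R _).le]
        field_simp
        norm_num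
      set ve := r e ^ 2 / a ^ 2 with hve
      have hve0 : 0 < ve := by positivity
      have hL0 : (0 : ℝ) ≤ phaseLength p₀ A B (τ i) := Nat.cast_nonneg _
      have hT := hτ0R (i + 1)
      rw [hLρ, hs2]
      calc _ ≤ a ^ 2 / (4 * ve) / τ (i + 1) *
            ((ve * (1 + ε) / 2) * phaseLength p₀ A B (τ i)) := by
            gcongr
            have := (hi2 e).2
            linarith
        _ = _ := by rw [hb]; field_simp; ring
    · refine le_trans ?_ h2
      exact Finset.sum_nonneg fun v _ => mul_nonneg measureReal_nonneg (Real.exp_pos _).le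
  · intro i hi
    obtain ⟨-, -, -, hi4, -⟩ := hi₀ i hi
    refine h.survivalMean_one_succ_le hp hp1.le home i rfl (hτ0 i) hε1.le
      (r := fun e => (1 - ε) * r e * √(τ i : ℝ)) (s := fun e => s e i) (fun e => hs0 e i) ?_ hi4
    intro e
    have hre := hr0 e
    have h4 := Real.sqrt_pos.mpr (hτ0R i)
    rw [hγ]
    congr 1
    simp only [hs]
    field_simp
  · intro i hi
    obtain ⟨-, -, -, -, hi5⟩ := hi₀ i hi
    rw [hτs i, add_sub_cancel_left]
    have hM := hM0 i
    have h4 : α * ((phaseLength p₀ A B (τ i) : ℝ) / τ i) =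
        α * ((phaseLength p₀ A B (τ i) : ℝ) * maxShift p₀ (τ i) / τ i) / maxShift p₀ (τ i) := by
      have := hτ0R i
      field_simp
    rw [h4, div_mul_eq_mul_div]
    exact div_le_div_of_nonneg_right (hi5.trans_eq (mul_comm _ _)) hM.le

/-- The tail of the hitting time. -/
theorem IsSweepingRandomness.isBigO_lt_sweepingTime
    (h : IsSweepingRandomness μ p p₀ A B l₀.length ξ Z) {α C : ℝ} {i₀ : ℕ} {home : ℤ × ℤ}
    (hp₀' : p₀ < 1) (hA : 0 < A) (hB : 0 < B) (hα : 0 < α) (hl₀ : 0 < l₀.length)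
    (hC : ∀ i ≥ i₀, survivalMean p₀ A B l₀ μ ξ Z home i (fun _ => 1) ≤
      C * (startTime p₀ A B l₀.length i : ℝ) ^ (-α)) :
    (fun t : ℕ => μ.real {ω | (t : ℕ∞) < sweepingTime p₀ A B l₀ ξ Z home ω})
      =O[atTop] fun t : ℕ => (t : ℝ) ^ (-α) := by
  set τ : ℕ → ℕ := startTime p₀ A B l₀.length with hτ
  have hmono : StrictMono τ := strictMono_nat_of_lt_succ (startTime_lt_succ hp₀' hA hl₀)
  have hτ0R : ∀ i, (0 : ℝ) < τ i := fun i => by exact_mod_cast startTime_pos hl₀ i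
  -- Starting times eventually at most double, so passing from them to arbitrary times costs only
  -- the factor `2 ^ α`.
  have hdouble : ∀ᶠ i in atTop, (τ (i + 1) : ℝ) ≤ 2 * τ i := by
    have h1 := hmono.tendsto_atTop.eventually
      ((tendsto_phaseLength_div hp₀' hA hB).eventually_le_const one_pos)
    filter_upwards [h1] with i hi
    rw [div_le_one (hτ0R i)] at hi
    have : (τ (i + 1) : ℝ) = τ i + phaseLength p₀ A B (τ i) := by
      rw [hτ, startTime]; push_cast; rfl
    linarith
  obtain ⟨i₁, hi₁⟩ := eventually_atTop.mp hdouble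
  set j := max i₀ i₁ with hj
  refine Asymptotics.IsBigO.of_bound (C * 2 ^ α) ?_
  filter_upwards [eventually_ge_atTop (τ j), eventually_gt_atTop 0] with t ht ht0
  have ht0R : (0 : ℝ) < t := by exact_mod_cast ht0
  obtain ⟨i, hij, hit, hti⟩ : ∃ i ≥ j, τ i ≤ t ∧ t < τ (i + 1) := by
    have hex : ∃ n, t < τ n := ⟨t + 1, lt_of_lt_of_le (Nat.lt_succ_self t) hmono.le_apply⟩
    have hfind := Nat.find_spec hex
    have hpos : j < Nat.find hex := by
      by_contra hcon
      exact absurd (hfind.trans_le (hmono.monotone (not_lt.mp hcon))) (not_lt.mpr ht)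
    refine ⟨Nat.find hex - 1, by omega, not_lt.mp (Nat.find_min hex (by omega)), ?_⟩
    rwa [Nat.sub_add_cancel (by omega)]
  rw [Real.norm_of_nonneg measureReal_nonneg, Real.norm_of_nonneg (by positivity)]
  have h1 : μ.real {ω | (t : ℕ∞) < sweepingTime p₀ A B l₀ ξ Z home ω} ≤
      μ.real {ω | (τ i : ℕ∞) < sweepingTime p₀ A B l₀ ξ Z home ω} := by
    refine measureReal_mono ?_ (measure_ne_top _ _)
    intro ω (hω : (t : ℕ∞) < _)
    exact lt_of_le_of_lt (by exact_mod_cast hit) hω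
  have h2 := h.measureReal_lt_sweepingTime_le hp₀' hA hl₀ home i
  have h3 := hC i (le_trans (le_max_left _ _) hij)
  have hpow : (0 : ℝ) < (τ i : ℝ) ^ (-α) := Real.rpow_pos_of_pos (hτ0R i) _
  have hC0 : 0 ≤ C := by
    by_contra hneg
    have h5 := mul_neg_of_neg_of_pos (not_le.mp hneg) hpow
    have h6 : 0 ≤ μ.real {ω | (τ i : ℕ∞) < sweepingTime p₀ A B l₀ ξ Z home ω} :=
      measureReal_nonneg
    linarith
  have ht2 : (t : ℝ) ≤ 2 * τ i := by
    have h5 : (t : ℝ) ≤ τ (i + 1) := by exact_mod_cast hti.le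
    exact h5.trans (hi₁ i (le_trans (le_max_right _ _) hij))
  have h4 : (τ i : ℝ) ^ (-α) ≤ 2 ^ α * (t : ℝ) ^ (-α) := by
    have h5 : (2 * (τ i : ℝ)) ^ (-α) ≤ (t : ℝ) ^ (-α) :=
      Real.rpow_le_rpow_of_nonpos ht0R ht2 (by linarith)
    rw [Real.mul_rpow (by norm_num) (hτ0R i).le, Real.rpow_neg (by norm_num : (0 : ℝ) ≤ 2)] at h5
    have h6 : (0 : ℝ) < 2 ^ α := by positivity
    rwa [inv_mul_le_iff₀ h6] at h5
  calc _ ≤ C * (τ i : ℝ) ^ (-α) := h1.trans (h2.trans h3)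
    _ ≤ C * (2 ^ α * (t : ℝ) ^ (-α)) := by gcongr
    _ = _ := by ring

/-- A random variable whose tail is summable has a finite mean. -/
theorem lintegral_lt_top_of_summable {T : Ω → ℕ∞}
    (hT : Summable fun t : ℕ => μ.real {ω | (t : ℕ∞) < T ω}) :
    ∫⁻ ω, (T ω : ENNReal) ∂μ < ⊤ := by
  -- The tail sum bounds `T` pointwise. Measurable hulls of the tail events have the same measure
  -- and make it possible to integrate without measurability of `T`.
  have hpt : ∀ ω, (T ω : ENNReal) ≤
      ∑' t : ℕ, (toMeasurable μ {ω | (t : ℕ∞) < T ω}).indicator (fun _ => (1 : ENNReal)) ω := by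
    intro ω
    have hsum : ∀ n : ℕ, (n : ℕ∞) ≤ T ω → (n : ENNReal) ≤
        ∑' t : ℕ, (toMeasurable μ {ω | (t : ℕ∞) < T ω}).indicator
          (fun _ => (1 : ENNReal)) ω := by
      intro n hn
      refine le_trans ?_ (ENNReal.sum_le_tsum (Finset.range n))
      have h1 : ∀ t ∈ Finset.range n, (toMeasurable μ {ω | (t : ℕ∞) < T ω}).indicator
          (fun _ => (1 : ENNReal)) ω = 1 := by
        intro t ht
        refine Set.indicator_of_mem (subset_toMeasurable _ _ ?_) _
        exact lt_of_lt_of_le (by exact_mod_cast Finset.mem_range.mp ht) hn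
      rw [Finset.sum_congr rfl h1]
      simp
    rcases hω : T ω with _ | n
    · have : ∀ n : ℕ, (n : ENNReal) ≤ ∑' t : ℕ, (toMeasurable μ {ω | (t : ℕ∞) < T ω}).indicator
          (fun _ => (1 : ENNReal)) ω := fun n => hsum n (by rw [hω]; exact le_top)
      refine le_of_le_of_eq le_top (Eq.symm ?_)
      exact ENNReal.eq_top_of_forall_nnreal_le fun r =>
        le_trans (by exact_mod_cast Nat.le_ceil r) (this ⌈r⌉₊)
    · exact hsum n hω.ge
  calc ∫⁻ ω, (T ω : ENNReal) ∂μ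
      ≤ ∫⁻ ω, ∑' t : ℕ, (toMeasurable μ {ω | (t : ℕ∞) < T ω}).indicator
          (fun _ => (1 : ENNReal)) ω ∂μ := lintegral_mono hpt
    _ = ∑' t : ℕ, μ {ω | (t : ℕ∞) < T ω} := by
        rw [lintegral_tsum fun t =>
          (measurable_const.indicator (measurableSet_toMeasurable _ _)).aemeasurable]
        refine tsum_congr fun t => ?_
        rw [lintegral_indicator (measurableSet_toMeasurable _ _), setLIntegral_one,
          measure_toMeasurable]
    _ = ∑' t : ℕ, ENNReal.ofReal (μ.real {ω | (t : ℕ∞) < T ω}) := by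
        refine tsum_congr fun t => ?_
        rw [measureReal_def, ENNReal.ofReal_toReal (measure_ne_top _ _)]
    _ < ⊤ := by
        rw [← ENNReal.ofReal_tsum_of_nonneg (fun t => measureReal_nonneg) hT]
        exact ENNReal.ofReal_lt_top

end Final

end GuidedWalk

theorem mainTheorem3 (p₀ α a A B : ℝ) (hp₀ : 0 < p₀) (hp₀' : p₀ < 1) (hα : 0 < α) (ha : 0 < a)
    (hcond : (1 - 4 * Real.exp (-a ^ 2 / 4 + 2 * α)) *
      ((1 - p₀) ^ 2 / (2 * a ^ 2 * p₀ * √(3 - 2 * p₀))) > α)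
    (hA : A = a * √(p₀ / 2) * √(3 - 2 * p₀)) (hB : B = a * √(p₀ / 2))
    (p : ℝ) (hp : 0 ≤ p) (hpp₀ : p ≤ p₀)
    (l₀ : List GuidedWalk.Dir) (hl₀ : 2 ≤ l₀.length) (hl₀' : GuidedWalk.displacement l₀ = 0)
    {Ω : Type*} [MeasurableSpace Ω] (μ : MeasureTheory.Measure Ω)
    [MeasureTheory.IsProbabilityMeasure μ]
    (ξ : ℕ → Ω → GuidedWalk.Outcome) (Z : ℕ → Ω → ℕ)
    (hrand : GuidedWalk.IsSweepingRandomness μ p p₀ A B l₀.length ξ Z) (home : ℤ × ℤ) :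
    ((fun t : ℕ => μ.real {ω | (t : ℕ∞) < GuidedWalk.sweepingTime p₀ A B l₀ ξ Z home ω})
        =O[Filter.atTop] fun t : ℕ => (t : ℝ) ^ (-α)) ∧
      (1 < α →
        ∫⁻ ω, (GuidedWalk.sweepingTime p₀ A B l₀ ξ Z home ω : ENNReal) ∂μ < ⊤) := by
  have h3 : 0 < 3 - 2 * p₀ := by linarith
  have hA0 : 0 < A := by rw [hA]; positivity
  have hB0 : 0 < B := by rw [hB]; positivity
  obtain ⟨C, i₀, hC⟩ := hrand.exists_survivalMean_le hp₀ hp₀' hα ha hcond hA hB hp hpp₀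
    (by omega) home
  have hO := hrand.isBigO_lt_sweepingTime hp₀' hA0 hB0 hα (by omega) hC
  refine ⟨hO, fun h1 => GuidedWalk.lintegral_lt_top_of_summable ?_⟩
  exact summable_of_isBigO_nat (Real.summable_nat_rpow.mpr (by linarith)) hO
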